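/- Let $m_1,m_2\in\mathbb N$, $m=m_1+m_2$, $0<r<\infty$, and $j=\begin{bmatrix} I_{m_1}&0\\0&-I_{m_2}\end{bmatrix}$. Let $\mathcal U^{p\times q}[0,r]$ denote the class of complex $p\times q$ matrix functions $\mathcal G$ that are differentiable on $[0,r]$ (one-sidedly at the endpoints) and satisfy $\mathcal G'(x)=\mathcal G'(0)+\int_0^x\mathcal G''(t)\,dt$ for all $x\in[0,r]$ with some $\mathcal G''$ whose entries belong to $L_2(0,r)$. Theorem 2.5. Let $\beta\in\mathcal U^{m_2\times m}[0,r]$ satisfy $$\beta(x)j\beta(x)^*=0,\qquad \beta'(x)j\beta(x)^*=\mathrm i I_{m_2}\qquad(0\le x\le r).$$ Define bounded operators $A$ and $K$ on $L_2^{m_2}(0,r)$ by $$(Af)(x)=\int_0^x(t-x)f(t)\,dt,\qquad (Kf)(x)=\mathrm i\,\beta(x)j\int_0^x\beta(t)^*f(t)\,dt.$$ Then $K$ is linearly similar to $A$: there are $u\in\mathcal U^{m_2\times m_2}[0,r]$ with $u(x)^*=u(x)^{-1}$ for all $x\in[0,r]$, and a measurable $m_2\times m_2$ matrix function $\mathcal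 V(x,t)$ with $$\sup_{0\le t\le x\le r}\|\mathcal V(x,t)\|<\infty,$$ such that the operator $V$ on $L_2^{m_2}(0,r)$ given by $$(Vf)(x)=u(x)\Big(f(x)+\int_0^x\mathcal V(x,t)f(t)\,dt\Big)$$ is bounded with bounded inverse, and $K=VAV^{-1}$. -/

import Mathlib

open MeasureTheory Set
open scoped Matrix Matrix.Norms.L2Operator

noncomputable section

namespace CanonicalSystem

/-- The class `𝒰^{p×q}[0,r]`, entrywise: every entry of `G` is differentiable on `[0,r]` (one-sidedly
at the endpoints) and its derivative satisfies `G'(x) = G'(0) + ∫₀ˣ G''(t) dt` on `[0,r]` with some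
`G'' ∈ L₂(0,r)`. -/
def MemU {p q : Type*} (r : ℝ) (G : ℝ → Matrix p q ℂ) : Prop :=
  ∀ i j, DifferentiableOn ℝ (fun x => G x i j) (Icc 0 r) ∧
    ∃ g : ℝ → ℂ, MemLp g 2 (volume.restrict (Ioo 0 r)) ∧
      ∀ x ∈ Icc 0 r, derivWithin (fun y => G y i j) (Icc 0 r) x =
        derivWithin (fun y => G y i j) (Icc 0 r) 0 + ∫ t in (0 : ℝ)..x, g t

/-- The (entrywise) derivative `G'(x)` of a matrix function on `[0,r]`. -/
def matDeriv {p q : Type*} (r : ℝ) (G : ℝ → Matrix p q ℂ) (x : ℝ) : Matrix p q ℂ :=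
  Matrix.of fun i j => derivWithin (fun y => G y i j) (Icc 0 r) x

/-- The signature matrix `j = diag(I_{m₁}, -I_{m₂})`. -/
def sgnJ (m₁ m₂ : ℕ) : Matrix (Fin m₁ ⊕ Fin m₂) (Fin m₁ ⊕ Fin m₂) ℂ :=
  Matrix.fromBlocks 1 0 0 (-1)

/-- The identities `β j β* ≡ 0` and `β' j β* ≡ i I` on `[0,r]`. -/
def IsNormalized {m₁ m₂ : ℕ} (r : ℝ) (β : ℝ → Matrix (Fin m₂) (Fin m₁ ⊕ Fin m₂) ℂ) : Prop :=
  ∀ x ∈ Icc 0 r, β x * sgnJ m₁ m₂ * (β x)ᴴ = 0 ∧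
    matDeriv r β x * sgnJ m₁ m₂ * (β x)ᴴ = Complex.I • (1 : Matrix (Fin m₂) (Fin m₂) ℂ)

/-- The Hilbert space `L₂^n(0,r)` of square integrable `ℂⁿ`-valued functions. -/
abbrev L2 (n : ℕ) (r : ℝ) : Type :=
  Lp (EuclideanSpace ℂ (Fin n)) 2 (volume.restrict (Ioo (0 : ℝ) r))

/-- The function `x ↦ ∫₀ˣ (t - x) f(t) dt`. -/
def Afun {n : ℕ} (f : ℝ → EuclideanSpace ℂ (Fin n)) (x : ℝ) : EuclideanSpace ℂ (Fin n) :=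
  ∫ t in (0 : ℝ)..x, (t - x) • f t

/-- The function `x ↦ i β(x) j ∫₀ˣ β(t)* f(t) dt`. -/
def Kfun {m₁ m₂ : ℕ} (β : ℝ → Matrix (Fin m₂) (Fin m₁ ⊕ Fin m₂) ℂ)
    (f : ℝ → EuclideanSpace ℂ (Fin m₂)) (x : ℝ) : EuclideanSpace ℂ (Fin m₂) :=
  Complex.I • Matrix.toEuclideanLin (β x * sgnJ m₁ m₂)
    (∫ t in (0 : ℝ)..x, Matrix.toEuclideanLin (β t)ᴴ (f t))

section Helpers

/-- What is needed of a function-level operator to induce a bounded operator on `L₂^n(0,r)`. -/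
structure IsL2Op {n : ℕ} (r : ℝ)
    (T : (ℝ → EuclideanSpace ℂ (Fin n)) → ℝ → EuclideanSpace ℂ (Fin n)) : Prop where
  cont : ∀ f, IntegrableOn f (Ioo 0 r) → ContinuousOn (T f) (Icc 0 r)
  congr : ∀ f g, f =ᵐ[volume.restrict (Ioo 0 r)] g → ∀ x ∈ Icc 0 r, T f x = T g x
  add : ∀ f g, IntegrableOn f (Ioo 0 r) → IntegrableOn g (Ioo 0 r) →
    ∀ x ∈ Icc 0 r, T (f + g) x = T f x + T g x
  smul : ∀ (c : ℂ) f, ∀ x ∈ Icc 0 r, T (c • f) x = c • T f x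
  bound : ∃ C, 0 ≤ C ∧ ∀ f, IntegrableOn f (Ioo 0 r) →
    ∀ x ∈ Icc 0 r, ‖T f x‖ ≤ C * ∫ t in Ioo 0 r, ‖f t‖

variable {n : ℕ} {r : ℝ}
  {T : (ℝ → EuclideanSpace ℂ (Fin n)) → ℝ → EuclideanSpace ℂ (Fin n)}

theorem L2.integrableOn (f : L2 n r) : IntegrableOn f (Ioo 0 r) :=
  (Lp.memLp f).integrable (by norm_num)

theorem L2.integral_norm_le (f : L2 n r) :
    ∫ t in Ioo 0 r, ‖f t‖ ≤ ((volume.restrict (Ioo (0 : ℝ) r)) univ ^ (1 / 2 : ℝ)).toReal * ‖f‖ := by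
  have h := eLpNorm_le_eLpNorm_mul_rpow_measure_univ (p := 1) (q := 2) (by norm_num)
    (Lp.aestronglyMeasurable f)
  have hfin : (volume.restrict (Ioo (0 : ℝ) r)) univ ≠ ⊤ := measure_ne_top _ _
  have hfin2 : (volume.restrict (Ioo (0 : ℝ) r)) univ ^ (1 / 2 : ℝ) ≠ ⊤ :=
    ENNReal.rpow_ne_top_of_nonneg (by norm_num) hfin
  have h2 := ENNReal.toReal_mono (ENNReal.mul_ne_top (Lp.eLpNorm_ne_top f) (by
    apply ENNReal.rpow_ne_top_of_nonneg _ hfin; norm_num)) h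
  rw [ENNReal.toReal_mul, eLpNorm_one_eq_lintegral_enorm] at h2
  rw [integral_norm_eq_lintegral_enorm (Lp.aestronglyMeasurable f), mul_comm, Lp.norm_def]
  convert h2 using 4
  norm_num

theorem IsL2Op.memLp (h : IsL2Op r T) (f : L2 n r) :
    MemLp (T f) 2 (volume.restrict (Ioo 0 r)) := by
  obtain ⟨C, -, hC⟩ := h.bound
  refine MemLp.of_bound (((h.cont f (L2.integrableOn f)).mono
    Ioo_subset_Icc_self).aestronglyMeasurable measurableSet_Ioo)
    (C * ∫ t in Ioo 0 r, ‖f t‖) ?_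
  filter_upwards [ae_restrict_mem measurableSet_Ioo] with x hx
  exact hC f (L2.integrableOn f) x (Ioo_subset_Icc_self hx)

/-- The bounded operator on `L₂^n(0,r)` sending (the class of) `f` to (the class of) `T f`. -/
def IsL2Op.toCLM (h : IsL2Op r T) : L2 n r →L[ℂ] L2 n r :=
  LinearMap.mkContinuousOfExistsBound
    { toFun := fun f => (h.memLp f).toLp
      map_add' := fun f g => by
        rw [← MemLp.toLp_add]
        apply MemLp.toLp_congr
        filter_upwards [ae_restrict_mem measurableSet_Ioo] with x hx
        have hx' := Ioo_subset_Icc_self hx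
        rw [h.congr _ _ (Lp.coeFn_add f g) x hx',
          h.add _ _ (L2.integrableOn f) (L2.integrableOn g) x hx']
        rfl
      map_smul' := fun c f => by
        rw [RingHom.id_apply, ← MemLp.toLp_const_smul]
        apply MemLp.toLp_congr
        filter_upwards [ae_restrict_mem measurableSet_Ioo] with x hx
        have hx' := Ioo_subset_Icc_self hx
        rw [h.congr _ _ (Lp.coeFn_smul c f) x hx', h.smul _ _ x hx']
        rfl }
    (by
      obtain ⟨C, hC0, hC⟩ := h.bound
      refine ⟨measureUnivNNReal (volume.restrict (Ioo (0 : ℝ) r)) ^ (ENNReal.toReal 2)⁻¹ *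
        (C * ((volume.restrict (Ioo (0 : ℝ) r)) univ ^ (1 / 2 : ℝ)).toReal),
        fun f => (Lp.norm_le_of_ae_bound
        (C := C * (((volume.restrict (Ioo (0 : ℝ) r)) univ ^ (1 / 2 : ℝ)).toReal * ‖f‖))
        (by positivity) ?_).trans (le_of_eq ?_)⟩
      · filter_upwards [ae_restrict_mem measurableSet_Ioo, (h.memLp f).coeFn_toLp] with x hx hx2
        have e := hC f (L2.integrableOn f) x (Ioo_subset_Icc_self hx)
        have e2 := mul_le_mul_of_nonneg_left (L2.integral_norm_le f) hC0
        simp only [LinearMap.coe_mk, AddHom.coe_mk]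
        rw [hx2]
        exact e.trans e2
      · ring)

theorem IsL2Op.coeFn_toCLM (h : IsL2Op r T) (f : L2 n r) :
    h.toCLM f =ᵐ[volume.restrict (Ioo 0 r)] T f :=
  (h.memLp f).coeFn_toLp

variable {E F : Type*} [NormedAddCommGroup E] [NormedSpace ℂ E]
  [NormedAddCommGroup F] [NormedSpace ℂ F]

theorem subset_Ioo_aux {x : ℝ} (hx : x ∈ Icc 0 r) : Ioo 0 x ⊆ Ioo 0 r :=
  Ioo_subset_Ioo_right hx.2

theorem integral_eq_Ioo {x : ℝ} (hx : x ∈ Icc 0 r) (g : ℝ → F) :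
    ∫ t in (0 : ℝ)..x, g t = ∫ t in Ioo 0 x, g t := by
  rw [intervalIntegral.integral_of_le hx.1, integral_Ioc_eq_integral_Ioo]

theorem exists_bound_aux {Q : ℝ → E →L[ℂ] F} (hQ : ContinuousOn Q (Icc 0 r)) :
    ∃ C, 0 ≤ C ∧ ∀ t ∈ Icc 0 r, ‖Q t‖ ≤ C := by
  obtain ⟨C, hC⟩ := isCompact_Icc.exists_bound_of_continuousOn hQ
  exact ⟨max C 0, le_max_right _ _, fun t ht => (hC t ht).trans (le_max_left _ _)⟩

theorem integrableOn_aux {Q : ℝ → E →L[ℂ] F} (hQ : ContinuousOn Q (Icc 0 r)) {f : ℝ → E}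
    (hf : IntegrableOn f (Ioo 0 r)) : IntegrableOn (fun t => Q t (f t)) (Ioo 0 r) := by
  obtain ⟨C, hC0, hC⟩ := exists_bound_aux hQ
  have hm : AEStronglyMeasurable Q (volume.restrict (Ioo 0 r)) :=
    (hQ.mono Ioo_subset_Icc_self).aestronglyMeasurable measurableSet_Ioo
  refine Integrable.mono' (hf.norm.const_mul C) ?_ ?_
  · exact isBoundedBilinearMap_apply.continuous.comp_aestronglyMeasurable
      (hm.prodMk hf.aestronglyMeasurable)
  · filter_upwards [ae_restrict_mem measurableSet_Ioo] with x hx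
    exact (Q x).le_of_opNorm_le (hC x (Ioo_subset_Icc_self hx)) (f x)

theorem continuousOn_prim_aux {g : ℝ → F} (hg : IntegrableOn g (Ioo 0 r)) :
    ContinuousOn (fun x => ∫ t in (0 : ℝ)..x, g t) (Icc 0 r) := by
  rcases lt_or_ge r 0 with h | h
  · simp [Icc_eq_empty_of_lt h]
  · have := intervalIntegral.continuousOn_primitive_interval (a := 0) (b := r) (f := g)
      (μ := volume) (by rwa [uIcc_of_le h, integrableOn_Icc_iff_integrableOn_Ioo])
    rwa [uIcc_of_le h] at this

/-- Operators `P(x) ∫₀ˣ Q(t) f(t) dt` with continuous coefficients are bounded on `L₂`. -/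
theorem isL2Op_aux {P : ℝ → E →L[ℂ] EuclideanSpace ℂ (Fin n)}
    {Q : ℝ → EuclideanSpace ℂ (Fin n) →L[ℂ] E}
    (hP : ContinuousOn P (Icc 0 r)) (hQ : ContinuousOn Q (Icc 0 r)) :
    IsL2Op r (fun f x => P x (∫ t in (0 : ℝ)..x, Q t (f t))) where
  cont f hf := hP.clm_apply (continuousOn_prim_aux (integrableOn_aux hQ hf))
  congr f g hfg x hx := by
    simp only [integral_eq_Ioo hx]
    congr 1
    refine integral_congr_ae ?_
    filter_upwards [ae_restrict_of_ae_restrict_of_subset (subset_Ioo_aux hx) hfg] with t ht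
    rw [ht]
  add f g hf hg x hx := by
    simp only [integral_eq_Ioo hx, Pi.add_apply, map_add]
    rw [integral_add ((integrableOn_aux hQ hf).mono_set (subset_Ioo_aux hx))
      ((integrableOn_aux hQ hg).mono_set (subset_Ioo_aux hx)), map_add]
  smul c f x hx := by
    simp only [integral_eq_Ioo hx, Pi.smul_apply, map_smul]
    rw [integral_smul, map_smul]
  bound := by
    obtain ⟨C, hC0, hC⟩ := exists_bound_aux hP
    obtain ⟨D, hD0, hD⟩ := exists_bound_aux hQ
    refine ⟨C * D, by positivity, fun f hf x hx => ?_⟩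
    refine ((P x).le_of_opNorm_le (hC x hx) _).trans ?_
    rw [mul_assoc]
    gcongr
    rw [integral_eq_Ioo hx, ← integral_const_mul]
    refine (norm_integral_le_integral_norm _).trans ?_
    refine (setIntegral_mono_set (integrableOn_aux hQ hf).norm
      (Filter.Eventually.of_forall fun _ => norm_nonneg _)
      (subset_Ioo_aux hx).eventuallyLE).trans ?_
    refine setIntegral_mono_on (integrableOn_aux hQ hf).norm (hf.norm.const_mul D)
      measurableSet_Ioo fun t ht => ?_
    exact (Q t).le_of_opNorm_le (hD t (Ioo_subset_Icc_self ht)) (f t)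

theorem IsL2Op.sub {S : (ℝ → EuclideanSpace ℂ (Fin n)) → ℝ → EuclideanSpace ℂ (Fin n)}
    (hT : IsL2Op r T) (hS : IsL2Op r S) : IsL2Op r (fun f x => T f x - S f x) where
  cont f hf := (hT.cont f hf).sub (hS.cont f hf)
  congr f g hfg x hx := by simp only [hT.congr f g hfg x hx, hS.congr f g hfg x hx]
  add f g hf hg x hx := by
    simp only [hT.add f g hf hg x hx, hS.add f g hf hg x hx]; abel
  smul c f x hx := by simp only [hT.smul c f x hx, hS.smul c f x hx, smul_sub]
  bound := by
    obtain ⟨C, hC0, hC⟩ := hT.bound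
    obtain ⟨D, hD0, hD⟩ := hS.bound
    refine ⟨C + D, by positivity, fun f hf x hx => (norm_sub_le _ _).trans ?_⟩
    rw [add_mul]
    exact add_le_add (hC f hf x hx) (hD f hf x hx)

theorem IsL2Op.of_eq {S : (ℝ → EuclideanSpace ℂ (Fin n)) → ℝ → EuclideanSpace ℂ (Fin n)}
    (hS : IsL2Op r S)
    (h : ∀ f, IntegrableOn f (Ioo 0 r) → ∀ x ∈ Icc 0 r, T f x = S f x)
    (hcongr : ∀ f g, f =ᵐ[volume.restrict (Ioo 0 r)] g → ∀ x ∈ Icc 0 r, T f x = T g x)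
    (hsmul : ∀ (c : ℂ) f, ∀ x ∈ Icc 0 r, T (c • f) x = c • T f x) : IsL2Op r T where
  cont f hf := (hS.cont f hf).congr fun x hx => h f hf x hx
  congr := hcongr
  add f g hf hg x hx := by
    rw [h _ (hf.add hg) x hx, h _ hf x hx, h _ hg x hx, hS.add f g hf hg x hx]
  smul := hsmul
  bound := by
    obtain ⟨C, hC0, hC⟩ := hS.bound
    exact ⟨C, hC0, fun f hf x hx => by rw [h f hf x hx]; exact hC f hf x hx⟩

theorem isL2Op_Afun (n : ℕ) (r : ℝ) : IsL2Op r (Afun (n := n)) := by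
  have h1 : ContinuousOn (fun t : ℝ => (t : ℂ) • ContinuousLinearMap.id ℂ
      (EuclideanSpace ℂ (Fin n))) (Icc 0 r) := by fun_prop
  have h2 : ContinuousOn (fun _ : ℝ => ContinuousLinearMap.id ℂ
      (EuclideanSpace ℂ (Fin n))) (Icc 0 r) := by fun_prop
  refine ((isL2Op_aux h2 h1).sub (isL2Op_aux h1 h2)).of_eq ?_ ?_ ?_
  · intro f hf x hx
    have i1 := (integrableOn_aux h1 hf).mono_set (subset_Ioo_aux hx)
    have i2 := hf.mono_set (subset_Ioo_aux hx)
    simp only [Afun, integral_eq_Ioo hx, smul_apply,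
      ContinuousLinearMap.id_apply] at i1 ⊢
    simp only [sub_smul, Complex.coe_smul] at i1 ⊢
    have i3 : IntegrableOn (fun t => x • f t) (Ioo 0 x) := i2.smul x
    rw [integral_sub i1 i3, integral_smul]
  · intro f g hfg x hx
    simp only [Afun, integral_eq_Ioo hx]
    refine integral_congr_ae ?_
    filter_upwards [ae_restrict_of_ae_restrict_of_subset (subset_Ioo_aux hx) hfg] with t ht
    rw [ht]
  · intro c f x hx
    simp only [Afun, integral_eq_Ioo hx, Pi.smul_apply]
    rw [← integral_smul]
    exact integral_congr_ae (Filter.Eventually.of_forall fun t => smul_comm _ _ _)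

theorem continuousOn_matCLM {p q : Type*} [Fintype p] [Fintype q] [DecidableEq q]
    {G : ℝ → Matrix p q ℂ} {s : Set ℝ} (hG : ContinuousOn G s) :
    ContinuousOn (fun x => (Matrix.toEuclideanLin (G x)).toContinuousLinearMap) s :=
  (LinearMap.continuous_of_finiteDimensional
    ((Matrix.toEuclideanLin (𝕜 := ℂ) (m := p) (n := q)).trans
      LinearMap.toContinuousLinearMap).toLinearMap).comp_continuousOn hG

theorem MemU.continuousOn {p q : Type*} {G : ℝ → Matrix p q ℂ} (hG : MemU r G) :
    ContinuousOn G (Icc 0 r) :=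
  continuousOn_pi.2 fun i => continuousOn_pi.2 fun j => (hG i j).1.continuousOn

theorem isL2Op_Kfun {m₁ m₂ : ℕ} {β : ℝ → Matrix (Fin m₂) (Fin m₁ ⊕ Fin m₂) ℂ} (hβ : MemU r β) :
    IsL2Op r (Kfun β) := by
  have hc := hβ.continuousOn
  have h1 : ContinuousOn (fun x => β x * sgnJ m₁ m₂) (Icc 0 r) :=
    (continuous_id.matrix_mul continuous_const).comp_continuousOn hc
  have h2 : ContinuousOn (fun x => (β x)ᴴ) (Icc 0 r) :=
    (continuous_id.matrix_conjTranspose).comp_continuousOn hc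
  have h := isL2Op_aux ((continuousOn_matCLM h1).const_smul Complex.I) (continuousOn_matCLM h2)
  have e : Kfun β = fun f x => (Complex.I •
      (Matrix.toEuclideanLin (β x * sgnJ m₁ m₂)).toContinuousLinearMap)
      (∫ t in (0 : ℝ)..x, (Matrix.toEuclideanLin (β t)ᴴ).toContinuousLinearMap (f t)) := by
    funext f x
    rw [smul_apply]
    rfl
  rw [e]
  exact h

end Helpers

/-- The operator `A = ∫₀ˣ (t - x) · dt` on `L₂^n(0,r)`. -/
def opA (n : ℕ) (r : ℝ) : L2 n r →L[ℂ] L2 n r := (isL2Op_Afun n r).toCLM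

/-- The operator `K = i β(x) j ∫₀ˣ β(t)* · dt` on `L₂^{m₂}(0,r)`. -/
def opK {m₁ m₂ : ℕ} {r : ℝ} (β : ℝ → Matrix (Fin m₂) (Fin m₁ ⊕ Fin m₂) ℂ) (hβ : MemU r β) :
    L2 m₂ r →L[ℂ] L2 m₂ r := (isL2Op_Kfun hβ).toCLM

theorem coeFn_opA {n : ℕ} {r : ℝ} (f : L2 n r) :
    opA n r f =ᵐ[volume.restrict (Ioo 0 r)] Afun f := (isL2Op_Afun n r).coeFn_toCLM f

theorem coeFn_opK {m₁ m₂ : ℕ} {r : ℝ} {β : ℝ → Matrix (Fin m₂) (Fin m₁ ⊕ Fin m₂) ℂ}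
    (hβ : MemU r β) (f : L2 m₂ r) :
    opK β hβ f =ᵐ[volume.restrict (Ioo 0 r)] Kfun β f := (isL2Op_Kfun hβ).coeFn_toCLM f

end CanonicalSystem

end

/-! Let `J` be integration from 0, so that `A = -J²`. The proof brings `K` to the form `-J(1 + R)J`
by a unitary change of frame, and then removes `R` by a transmutation operator `1 + W`.

Frame. Solve `u' = (i/2)(β' j β'*) u`, `u(0) = 1`, and put `η = u*β`, `γ = η'`. The coefficient is
skew-adjoint, so `u` is unitary and the identities `η j η* = 0`, `γ j η* = i` are kept; the
coefficient is chosen to give also `γ j γ* = 0` (`exists_normalizing_frame`). Conjugation by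
multiplication with `u` turns `K` into the Volterra operator with kernel `i η(x) j η(t)*`
(`opK_comp_frame`). Let `S` and `R` have kernels `i γ(x) j η(t)*` and `i γ(x) j γ(t)*`. The three
identities are diagonal values, and integrating the kernels gives: transformed `K` equals `J S`; `R
J = -J - S`; and the kernel of `R` is the `x`-primitive, without boundary term, of `q(x,t) = i γ'(x)
j γ(t)*`. Hence the transformed `K` is `-J(1 + R)J`, where formally `R = J Q`.

Transmutation. `J(1 + R)J(1 + W) = (1 + W)J²` is split by an auxiliary `Y` into `(1 + Y)J = J(1 +
W)` and `(1 + W)J = J(1 + R)(1 + Y)` (`exists_similarity`). Write `P = R + RY`, whose kernel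
satisfies `p_x = m` with `m = q + q ⋆ y`. The two relations are formally `y_x = -w_t` and `w_x = -(y
+ p)_t`, hence `(∂_x ± ∂_t)(y + p ± w) = m`. Integrating along the characteristics inside the
triangle, with zero incoming data, expresses `y`, `w`, `p` by `m`; since `m` depends on `y`, this is
a Volterra fixed point equation (`exists_kernel_fixedPoint`). It is a contraction in an
exponentially weighted sup norm, although `q` is only dominated by a square integrable function of
`x`. The integrated relations are then recovered without differentiating any kernel
(`integral_lineInt_add`).

Finally `1 + W` is invertible as a Volterra perturbation of the identity
(`IsBddKer.isUnit_one_add_op`), and `V` is multiplication by `u` composed with `1 + W`. -/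

noncomputable section

namespace CanonicalSystem


/-! ### Triangle integrals, a pointwise fixed point principle, exponential weights -/

section VolterraTools

open Filter Topology

variable {E : Type*} [NormedAddCommGroup E]

-- Integrals with variable limits are written throughout over the fixed interval `(0,r)` with a
-- cut-off, so that joint measurability and Fubini apply to a fixed measure; this lemma and the next
-- translate back.
variable [NormedSpace ℝ E] in
theorem setIntegral_ite_le {r x : ℝ} (hx : x ∈ Icc 0 r) (g : ℝ → E) :
    ∫ s in Ioo 0 r, (if s ≤ x then g s else 0) = ∫ s in (0 : ℝ)..x, g s := by
  have h : (fun s => if s ≤ x then g s else 0) = (Iic x).indicator g := by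
    funext s; simp [indicator]
  rw [h, setIntegral_indicator measurableSet_Iic, intervalIntegral.integral_of_le hx.1,
    ← integral_Icc_eq_integral_Ioc]
  have : (Ioo (0 : ℝ) r ∩ Iic x : Set ℝ) =ᵐ[volume] Icc 0 x := by
    have h1 : (Ioo (0 : ℝ) r : Set ℝ) =ᵐ[volume] Icc 0 r := Ioo_ae_eq_Icc
    have h2 := h1.inter (ae_eq_refl (Iic x))
    have h3 : Icc (0 : ℝ) r ∩ Iic x = Icc 0 x := by
      ext s; simp only [mem_inter_iff, mem_Icc, mem_Iic]
      exact ⟨fun h => ⟨h.1.1, h.2⟩, fun h => ⟨⟨h.1, h.2.trans hx.2⟩, h.2⟩⟩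
    rwa [h3] at h2
  exact setIntegral_congr_set this

variable [NormedSpace ℝ E] in
theorem setIntegral_ite_le_le {r x t : ℝ} (ht : 0 ≤ t) (htx : t ≤ x) (hx : x ≤ r) (g : ℝ → E) :
    ∫ s in Ioo 0 r, (if t ≤ s ∧ s ≤ x then g s else 0) = ∫ s in t..x, g s := by
  have h : (fun s => if t ≤ s ∧ s ≤ x then g s else 0) = (Icc t x).indicator g := by
    funext s; simp [indicator]
  rw [h, setIntegral_indicator measurableSet_Icc, intervalIntegral.integral_of_le htx,
    ← integral_Icc_eq_integral_Ioc]
  have : (Ioo (0 : ℝ) r ∩ Icc t x : Set ℝ) =ᵐ[volume] Icc t x := by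
    have h1 : (Ioo (0 : ℝ) r : Set ℝ) =ᵐ[volume] Icc 0 r := Ioo_ae_eq_Icc
    have h2 := h1.inter (ae_eq_refl (Icc t x))
    have h3 : Icc (0 : ℝ) r ∩ Icc t x = Icc t x :=
      inter_eq_right.2 (Icc_subset_Icc ht hx)
    rwa [h3] at h2
  exact setIntegral_congr_set this

variable [NormedSpace ℝ E] in
/-- Interchanging the order of integration over a triangle. -/
theorem integral_triangle_swap {a b : ℝ} (hab : a ≤ b) {F : ℝ → ℝ → E}
    (hF : Integrable (Function.uncurry F)
      ((volume.restrict (Ioc a b)).prod (volume.restrict (Ioc a b)))) :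
    ∫ s in a..b, ∫ t in a..s, F s t = ∫ t in a..b, ∫ s in t..b, F s t := by
  have hS : MeasurableSet {p : ℝ × ℝ | p.2 ≤ p.1} :=
    measurableSet_le measurable_snd measurable_fst
  have key := integral_integral_swap (f := fun s t => if t ≤ s then F s t else 0)
    (μ := volume.restrict (Ioc a b)) (ν := volume.restrict (Ioc a b)) (by
      refine (hF.indicator hS).congr (Eventually.of_forall fun p => ?_)
      simp [indicator, Function.uncurry])
  rw [intervalIntegral.integral_of_le hab, intervalIntegral.integral_of_le hab]
  have e1 : ∀ s ∈ Ioc a b, ∫ t in Ioc a b, (if t ≤ s then F s t else 0) = ∫ t in a..s, F s t := by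
    intro s hs
    have h : (fun t => if t ≤ s then F s t else 0) = (Iic s).indicator (F s) := by
      funext s; simp [indicator]
    rw [h, setIntegral_indicator measurableSet_Iic, Ioc_inter_Iic, min_eq_right hs.2,
      intervalIntegral.integral_of_le hs.1.le]
  have e2 : ∀ t ∈ Ioc a b, ∫ s in Ioc a b, (if t ≤ s then F s t else 0) = ∫ s in t..b, F s t := by
    intro t ht
    have h : (fun s => if t ≤ s then F s t else 0) = (Ici t).indicator (fun s => F s t) := by
      funext s; simp [indicator]
    have h2 : Ioc a b ∩ Ici t = Icc t b := by
      ext s; simp only [mem_inter_iff, mem_Ioc, mem_Ici, mem_Icc]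
      exact ⟨fun h => ⟨h.2, h.1.2⟩, fun h => ⟨⟨ht.1.trans_le h.1, h.2⟩, h.1⟩⟩
    rw [h, setIntegral_indicator measurableSet_Ici, h2, integral_Icc_eq_integral_Ioc,
      intervalIntegral.integral_of_le ht.2]
  rw [← setIntegral_congr_fun measurableSet_Ioc e1, ← setIntegral_congr_fun measurableSet_Ioc e2]
  exact key

/-- A contraction, in a weighted sup norm, of the bounded measurable functions has a fixed point. -/
theorem exists_measurable_fixedPoint [CompleteSpace E] {X : Type*} [MeasurableSpace X]
    (ω : X → ℝ) (T : (X → E) → X → E)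
    (hT : ∀ g, StronglyMeasurable g → (∃ D, ∀ p, ‖g p‖ ≤ D * ω p) →
      StronglyMeasurable (T g) ∧ ∃ D, ∀ p, ‖T g p‖ ≤ D * ω p)
    (hc : ∀ g g', StronglyMeasurable g → (∃ D, ∀ p, ‖g p‖ ≤ D * ω p) →
      StronglyMeasurable g' → (∃ D, ∀ p, ‖g' p‖ ≤ D * ω p) →
      ∀ D, (∀ p, ‖g p - g' p‖ ≤ D * ω p) → ∀ p, ‖T g p - T g' p‖ ≤ D / 2 * ω p) :
    ∃ g, StronglyMeasurable g ∧ (∃ D, ∀ p, ‖g p‖ ≤ D * ω p) ∧ T g = g := by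
  -- Picard iteration from zero, converging at every point with ratio 1/2. Genuine functions are
  -- used rather than almost everywhere classes, because the fixed point is later evaluated on
  -- sections and integrated along lines, which are null sets in the plane.
  set u : ℕ → X → E := fun k => T^[k] 0 with hu
  have hsucc : ∀ k, u (k + 1) = T (u k) := fun k => Function.iterate_succ_apply' T k 0
  have hadm : ∀ k, StronglyMeasurable (u k) ∧ ∃ D, ∀ p, ‖u k p‖ ≤ D * ω p := by
    intro k
    induction k with
    | zero => exact ⟨stronglyMeasurable_zero, 0, fun p => by simp [hu]⟩
    | succ k ih => rw [hsucc]; exact hT _ ih.1 ih.2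
  obtain ⟨D, hD⟩ := (hadm 1).2
  have hstep : ∀ k p, ‖u (k + 1) p - u k p‖ ≤ D / 2 ^ k * ω p := by
    intro k
    induction k with
    | zero => intro p; simpa [hu] using hD p
    | succ k ih =>
      intro p
      have := hc _ _ (hadm (k + 1)).1 (hadm (k + 1)).2 (hadm k).1 (hadm k).2 _ ih p
      rw [← hsucc, ← hsucc] at this
      refine this.trans (le_of_eq ?_)
      rw [pow_succ]; field_simp
  have hdist : ∀ p k, dist (u k p) (u (k + 1) p) ≤ 2 * (D * ω p) / 2 / 2 ^ k := by
    intro p k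
    rw [dist_comm, dist_eq_norm]
    refine (hstep k p).trans (le_of_eq ?_)
    field_simp
  have hlim : ∀ p, ∃ a, Tendsto (fun k => u k p) atTop (𝓝 a) := fun p =>
    cauchySeq_tendsto_of_complete (cauchySeq_of_le_geometric_two (hdist p))
  choose g hg using hlim
  have hgm : StronglyMeasurable g := stronglyMeasurable_of_tendsto atTop (fun k => (hadm k).1)
    (tendsto_pi_nhds.2 hg)
  have hgd : ∀ k p, ‖u k p - g p‖ ≤ 2 * D / 2 ^ k * ω p := by
    intro k p
    rw [← dist_eq_norm]
    refine (dist_le_of_le_geometric_two_of_tendsto (hdist p) (hg p) k).trans (le_of_eq ?_)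
    ring
  have hgb : ∃ D, ∀ p, ‖g p‖ ≤ D * ω p := ⟨2 * D, fun p => by simpa [hu] using hgd 0 p⟩
  refine ⟨g, hgm, hgb, ?_⟩
  funext p
  refine tendsto_nhds_unique (f := fun k => u (k + 1) p) ?_ ((tendsto_add_atTop_iff_nat 1).2 (hg p))
  rw [tendsto_iff_norm_sub_tendsto_zero]
  refine squeeze_zero (fun _ => norm_nonneg _) (fun k => ?_)
    (g := fun k : ℕ => D * ω p * (1 / 2) ^ k) ?_
  · rw [hsucc]
    refine (hc _ _ (hadm k).1 (hadm k).2 hgm hgb _ (hgd k) p).trans (le_of_eq ?_)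
    rw [div_pow, one_pow]; ring
  · simpa using (tendsto_pow_atTop_nhds_zero_of_lt_one (r := (1 / 2 : ℝ)) (by norm_num)
      (by norm_num)).const_mul (D * ω p)

/-- A square integrable weight is absorbed by a sufficiently fast exponential. -/
theorem exists_exp_weight {r : ℝ} {μ : ℝ → ℝ} (hμ : MemLp μ 2 (volume.restrict (Ioo 0 r)))
    {ε : ℝ} (hε : 0 < ε) :
    ∃ l : ℝ, 0 ≤ l ∧ ∀ x ∈ Icc 0 r,
      ∫ s in Ioo 0 r, (if s ≤ x then |μ s| * Real.exp (l * s) else 0) ≤ ε * Real.exp (l * x) := by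
  have hsq : Integrable (fun s => μ s ^ 2) (volume.restrict (Ioo 0 r)) := hμ.integrable_sq
  set S := ∫ s in Ioo 0 r, μ s ^ 2 with hS
  have hS0 : 0 ≤ S := integral_nonneg fun _ => sq_nonneg _
  -- With `X = exp (l x)` and `Y = exp (l s)`, the weighted inequality `|μ| Y ≤ X (η/2) μ² + Y² / (2
  -- η X)` is integrated below. These choices of `η` and `l` make the two terms at most `ε X / 2`
  -- and `ε X / 4`; the `+ 1` covers `S = 0`.
  set η : ℝ := ε / (S + 1) with hη
  have hη0 : 0 < η := by positivity
  set l : ℝ := 1 / (η * ε) with hl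
  have hl0 : 0 < l := by positivity
  refine ⟨l, hl0.le, fun x hx => ?_⟩
  rw [setIntegral_ite_le hx]
  have hI : IntervalIntegrable (fun s => μ s ^ 2) volume 0 x := by
    rw [intervalIntegrable_iff_integrableOn_Ioo_of_le hx.1]
    exact IntegrableOn.mono_set hsq (Ioo_subset_Ioo_right hx.2)
  have hI1 : IntervalIntegrable μ volume 0 x := by
    rw [intervalIntegrable_iff_integrableOn_Ioo_of_le hx.1]
    exact IntegrableOn.mono_set (hμ.integrable (by norm_num)) (Ioo_subset_Ioo_right hx.2)
  have hexp : ∀ c : ℝ, Continuous fun s => Real.exp (c * s) := fun c => by fun_prop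
  have hb : ∫ s in (0 : ℝ)..x, |μ s| * Real.exp (l * s) ≤
      ∫ s in (0 : ℝ)..x, Real.exp (l * x) * (η / 2 * μ s ^ 2) +
        Real.exp (-(l * x)) / (2 * η) * Real.exp (2 * l * s) := by
    refine intervalIntegral.integral_mono_on hx.1 ?_ ?_ fun s _ => ?_
    · exact (hI1.abs).mul_continuousOn (hexp l).continuousOn
    · exact ((hI.const_mul _).const_mul _).add (((hexp (2 * l)).intervalIntegrable _ _).const_mul _)
    · have e1 : Real.exp (2 * l * s) = Real.exp (l * s) ^ 2 := by
        rw [← Real.exp_nat_mul]; congr 1; push_cast; ring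
      rw [e1, Real.exp_neg]
      have hX := Real.exp_pos (l * x)
      set X := Real.exp (l * x)
      set Y := Real.exp (l * s)
      rw [← sub_nonneg]
      have : X * (η / 2 * μ s ^ 2) + X⁻¹ / (2 * η) * Y ^ 2 - |μ s| * Y =
          (η * X * |μ s| - Y) ^ 2 / (2 * η * X) := by
        rw [← sq_abs (μ s)]; field_simp; ring
      rw [this]; positivity
  refine hb.trans ?_
  rw [intervalIntegral.integral_add ((hI.const_mul _).const_mul _)
    (((hexp (2 * l)).intervalIntegrable _ _).const_mul _)]
  simp only [intervalIntegral.integral_const_mul]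
  have h1 : ∫ s in (0 : ℝ)..x, μ s ^ 2 ≤ S := by
    rw [intervalIntegral.integral_of_le hx.1, integral_Ioc_eq_integral_Ioo]
    exact setIntegral_mono_set hsq (Eventually.of_forall fun _ => sq_nonneg _)
      (Ioo_subset_Ioo_right hx.2).eventuallyLE
  have h2 : ∫ s in (0 : ℝ)..x, Real.exp (2 * l * s) ≤ Real.exp (l * x) ^ 2 / (2 * l) := by
    have := intervalIntegral.integral_comp_mul_left (a := 0) (b := x) Real.exp
      (c := 2 * l) (by positivity)
    rw [this, integral_exp, smul_eq_mul]
    have e1 : Real.exp (2 * l * x) = Real.exp (l * x) ^ 2 := by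
      rw [← Real.exp_nat_mul]; congr 1; push_cast; ring
    rw [e1, inv_mul_eq_div]
    gcongr
    simp
  have hX := Real.exp_pos (l * x)
  rw [Real.exp_neg]
  set X := Real.exp (l * x)
  calc X * (η / 2 * ∫ s in (0 : ℝ)..x, μ s ^ 2) +
        X⁻¹ / (2 * η) * ∫ s in (0 : ℝ)..x, Real.exp (2 * l * s)
      ≤ X * (η / 2 * (S + 1)) + X⁻¹ / (2 * η) * (X ^ 2 / (2 * l)) := by
        gcongr; linarith
    _ = X * (ε / 2) + X * (ε / 4) := by
        rw [hl, hη]; field_simp; ring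
    _ ≤ ε * X := by nlinarith

end VolterraTools


/-! ### The kernel equation in characteristic form -/

section VolterraKernels

open Filter Topology

variable {𝔸 : Type*} [NormedRing 𝔸] [NormedAlgebra ℝ 𝔸]

/-- Restriction of a kernel to the triangle `0 ≤ t ≤ x ≤ r`. -/
def cutTriangle (r : ℝ) (k : ℝ → ℝ → 𝔸) (x t : ℝ) : 𝔸 :=
  if 0 ≤ t ∧ t ≤ x ∧ x ≤ r then k x t else 0

/-- The integral of `m` over the segment of slope `-a` ending at `(x, t)`. -/
def lineInt (r a : ℝ) (m : ℝ → ℝ → 𝔸) (x t : ℝ) : 𝔸 :=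
  ∫ s in Ioo 0 r, if s ≤ x then m s (t + a * (x - s)) else 0

/-- The kernel `q + q ⋆ y` on the triangle. -/
def sourceKer (r : ℝ) (q y : ℝ → ℝ → 𝔸) : ℝ → ℝ → 𝔸 :=
  cutTriangle r fun x t => q x t + ∫ s in Ioo 0 r, if t ≤ s ∧ s ≤ x then q x s * y s t else 0

omit [NormedAlgebra ℝ 𝔸] in
theorem stronglyMeasurable_cutTriangle {r : ℝ} {k : ℝ → ℝ → 𝔸}
    (hk : StronglyMeasurable (Function.uncurry k)) :
    StronglyMeasurable (Function.uncurry (cutTriangle r k)) := by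
  have : MeasurableSet {p : ℝ × ℝ | 0 ≤ p.2 ∧ p.2 ≤ p.1 ∧ p.1 ≤ r} :=
    (measurableSet_le measurable_const measurable_snd).inter
      ((measurableSet_le measurable_snd measurable_fst).inter
        (measurableSet_le measurable_fst measurable_const))
  exact StronglyMeasurable.ite this hk stronglyMeasurable_const

theorem stronglyMeasurable_lineInt {r a : ℝ} {m : ℝ → ℝ → 𝔸}
    (hm : StronglyMeasurable (Function.uncurry m)) :
    StronglyMeasurable (Function.uncurry (lineInt r a m)) := by
  have h1 : StronglyMeasurable (fun z : (ℝ × ℝ) × ℝ => m z.2 (z.1.2 + a * (z.1.1 - z.2))) :=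
    hm.comp_measurable (g := fun z : (ℝ × ℝ) × ℝ => (z.2, z.1.2 + a * (z.1.1 - z.2)))
      (by fun_prop)
  have h2 : MeasurableSet {z : (ℝ × ℝ) × ℝ | z.2 ≤ z.1.1} :=
    measurableSet_le (by fun_prop) (by fun_prop)
  exact (StronglyMeasurable.ite h2 h1 stronglyMeasurable_const).integral_prod_right
    (f := fun (p : ℝ × ℝ) s => if s ≤ p.1 then m s (p.2 + a * (p.1 - s)) else 0)

theorem stronglyMeasurable_sourceKer {r : ℝ} {q y : ℝ → ℝ → 𝔸}
    (hq : StronglyMeasurable (Function.uncurry q)) (hy : StronglyMeasurable (Function.uncurry y)) :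
    StronglyMeasurable (Function.uncurry (sourceKer r q y)) := by
  refine stronglyMeasurable_cutTriangle (hq.add ?_)
  have h1 : StronglyMeasurable (fun z : (ℝ × ℝ) × ℝ => q z.1.1 z.2 * y z.2 z.1.2) :=
    (hq.comp_measurable (g := fun z : (ℝ × ℝ) × ℝ => (z.1.1, z.2)) (by fun_prop)).mul
      (hy.comp_measurable (g := fun z : (ℝ × ℝ) × ℝ => (z.2, z.1.2)) (by fun_prop))
  have h2 : MeasurableSet {z : (ℝ × ℝ) × ℝ | z.1.2 ≤ z.2 ∧ z.2 ≤ z.1.1} :=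
    MeasurableSet.inter (s₁ := {z : (ℝ × ℝ) × ℝ | z.1.2 ≤ z.2}) (s₂ := {z | z.2 ≤ z.1.1})
      (measurableSet_le (by fun_prop) (by fun_prop)) (measurableSet_le (by fun_prop) (by fun_prop))
  exact (StronglyMeasurable.ite h2 h1 stronglyMeasurable_const).integral_prod_right
    (f := fun (p : ℝ × ℝ) s => if p.2 ≤ s ∧ s ≤ p.1 then q p.1 s * y s p.2 else 0)

omit [NormedAlgebra ℝ 𝔸] in
theorem integrable_lineInt {r a : ℝ} {m : ℝ → ℝ → 𝔸}
    (hm : StronglyMeasurable (Function.uncurry m)) {κ : ℝ → ℝ}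
    (hκ : IntegrableOn κ (Ioo 0 r)) (hmκ : ∀ s τ, ‖m s τ‖ ≤ κ s) (x t : ℝ) :
    IntegrableOn (fun s => if s ≤ x then m s (t + a * (x - s)) else 0) (Ioo 0 r) := by
  refine Integrable.mono' hκ ?_ (Eventually.of_forall fun s => ?_)
  · refine (StronglyMeasurable.ite (measurableSet_le measurable_id measurable_const) ?_
      stronglyMeasurable_const).aestronglyMeasurable
    exact hm.comp_measurable (g := fun s => (s, t + a * (x - s))) (by fun_prop)
  · split_ifs
    · exact hmκ _ _
    · simpa using (norm_nonneg _).trans (hmκ s 0)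

/-- The majorant depends on the first variable only, so the slope `a` disappears from the estimate
and all three families of lines obey the same bound. -/
theorem norm_lineInt_sub_le {r a : ℝ} {m m' : ℝ → ℝ → 𝔸}
    (hm : StronglyMeasurable (Function.uncurry m))
    (hm' : StronglyMeasurable (Function.uncurry m')) {κ κ' ν : ℝ → ℝ}
    (hκ : IntegrableOn κ (Ioo 0 r)) (hmκ : ∀ s τ, ‖m s τ‖ ≤ κ s)
    (hκ' : IntegrableOn κ' (Ioo 0 r)) (hmκ' : ∀ s τ, ‖m' s τ‖ ≤ κ' s)
    (hν : IntegrableOn ν (Ioo 0 r)) (hmν : ∀ s τ, ‖m s τ - m' s τ‖ ≤ ν s) (x t : ℝ) :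
    ‖lineInt r a m x t - lineInt r a m' x t‖ ≤
      ∫ s in Ioo 0 r, if s ≤ x then ν s else 0 := by
  rw [lineInt, lineInt, ← integral_sub (integrable_lineInt hm hκ hmκ x t)
    (integrable_lineInt hm' hκ' hmκ' x t)]
  refine norm_integral_le_of_norm_le (Integrable.mono' hν.norm ?_ ?_)
    (Eventually.of_forall fun s => ?_)
  · have : (fun s => if s ≤ x then ν s else 0) = (Iic x).indicator ν := by
      funext s; simp [indicator]
    rw [this]
    exact hν.aestronglyMeasurable.indicator measurableSet_Iic
  · refine Eventually.of_forall fun s => ?_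
    split_ifs <;> simp
  · split_ifs
    · exact hmν _ _
    · simp

theorem norm_lineInt_le {r a : ℝ} {m : ℝ → ℝ → 𝔸} {κ : ℝ → ℝ}
    (hκ : IntegrableOn κ (Ioo 0 r)) (hmκ : ∀ s τ, ‖m s τ‖ ≤ κ s) (x t : ℝ) :
    ‖lineInt r a m x t‖ ≤ ∫ s in Ioo 0 r, κ s := by
  refine norm_integral_le_of_norm_le hκ (Eventually.of_forall fun s => ?_)
  split_ifs
  · exact hmκ _ _
  · simpa using (norm_nonneg _).trans (hmκ s 0)

omit [NormedAlgebra ℝ 𝔸] in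
theorem integrable_mul_section {r : ℝ} {q y : ℝ → ℝ → 𝔸}
    (hq : StronglyMeasurable (Function.uncurry q)) (hy : StronglyMeasurable (Function.uncurry y))
    {μ : ℝ → ℝ} (hqμ : ∀ x t, ‖q x t‖ ≤ μ x) {l D : ℝ} (hl : 0 ≤ l)
    (hD : ∀ x t, ‖y x t‖ ≤ D * Real.exp (l * x)) (x t : ℝ) :
    IntegrableOn (fun s => if t ≤ s ∧ s ≤ x then q x s * y s t else 0) (Ioo 0 r) := by
  have hD0 : 0 ≤ D := by
    have := (norm_nonneg _).trans (hD 0 0); simpa using this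
  refine Measure.integrableOn_of_bounded (M := μ x * (D * Real.exp (l * x)))
    (by simp) ?_ (Eventually.of_forall fun s => ?_)
  · refine (StronglyMeasurable.ite ((measurableSet_le measurable_const measurable_id).inter
      (measurableSet_le measurable_id measurable_const)) ?_
      stronglyMeasurable_const).aestronglyMeasurable
    exact (hq.comp_measurable (g := fun s => (x, s)) (by fun_prop)).mul
      (hy.comp_measurable (g := fun s => (s, t)) (by fun_prop))
  · have h0 : 0 ≤ μ x := (norm_nonneg _).trans (hqμ x 0)
    split_ifs with h
    · refine (norm_mul_le _ _).trans (mul_le_mul (hqμ _ _) ((hD _ _).trans ?_) (norm_nonneg _) h0)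
      have := h.2
      gcongr
    · simp only [norm_zero]; positivity

/-- In `q ⋆ y` only `s ≤ x` occurs, where the weight is at most its value at `x`; the integration
costs a factor `r`. The resulting profile `μ x * exp (l x)` is the one that `exists_exp_weight`
makes small after one more integration. -/
theorem norm_sourceKer_sub_le {r : ℝ} (hr : 0 ≤ r) {q y y' : ℝ → ℝ → 𝔸}
    (hq : StronglyMeasurable (Function.uncurry q)) (hy : StronglyMeasurable (Function.uncurry y))
    (hy' : StronglyMeasurable (Function.uncurry y'))
    {μ : ℝ → ℝ} (hqμ : ∀ x t, ‖q x t‖ ≤ μ x) {l D₁ D₂ D : ℝ} (hl : 0 ≤ l)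
    (hD₁ : ∀ x t, ‖y x t‖ ≤ D₁ * Real.exp (l * x)) (hD₂ : ∀ x t, ‖y' x t‖ ≤ D₂ * Real.exp (l * x))
    (hD : ∀ x t, ‖y x t - y' x t‖ ≤ D * Real.exp (l * x)) (x t : ℝ) :
    ‖sourceKer r q y x t - sourceKer r q y' x t‖ ≤ r * D * (μ x * Real.exp (l * x)) := by
  have hD0 : 0 ≤ D := by
    have := (norm_nonneg _).trans (hD 0 0); simpa using this
  have h0 : 0 ≤ μ x := (norm_nonneg _).trans (hqμ x 0)
  unfold sourceKer cutTriangle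
  split_ifs
  · rw [add_sub_add_left_eq_sub, ← integral_sub (integrable_mul_section hq hy hqμ hl hD₁ x t)
      (integrable_mul_section hq hy' hqμ hl hD₂ x t)]
    have := norm_setIntegral_le_of_norm_le_const (μ := volume) (s := Ioo 0 r)
      (f := fun s => (if t ≤ s ∧ s ≤ x then q x s * y s t else 0) -
        (if t ≤ s ∧ s ≤ x then q x s * y' s t else 0)) (C := μ x * (D * Real.exp (l * x)))
      (by simp) (fun s _ => ?_)
    · refine this.trans (le_of_eq ?_)
      simp [Measure.real, hr]; ring
    · split_ifs with h
      · rw [← mul_sub]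
        refine (norm_mul_le _ _).trans
          (mul_le_mul (hqμ _ _) ((hD _ _).trans ?_) (norm_nonneg _) h0)
        have := h.2
        gcongr
      · simp only [sub_zero, norm_zero]; positivity
  · simp only [sub_zero, norm_zero]; positivity

theorem norm_sourceKer_le {r : ℝ} (hr : 0 ≤ r) {q y : ℝ → ℝ → 𝔸}
    (hq : StronglyMeasurable (Function.uncurry q)) (hy : StronglyMeasurable (Function.uncurry y))
    {μ : ℝ → ℝ} (hqμ : ∀ x t, ‖q x t‖ ≤ μ x) {l D : ℝ} (hl : 0 ≤ l)
    (hD : ∀ x t, ‖y x t‖ ≤ D * Real.exp (l * x)) (x t : ℝ) :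
    ‖sourceKer r q y x t‖ ≤ (1 + r * D * Real.exp (l * r)) * μ x := by
  have hD0 : 0 ≤ D := by
    have := (norm_nonneg _).trans (hD 0 0); simpa using this
  have h0 : 0 ≤ μ x := (norm_nonneg _).trans (hqμ x 0)
  -- For `x > r` the weight at `x` exceeds `exp (l r)`, but the kernel is cut off there.
  by_cases hx : x ≤ r
  · have h1 := norm_sourceKer_sub_le hr hq hy (y' := fun _ _ => 0) stronglyMeasurable_const hqμ hl
      hD (D₂ := 0) (by simp) (by simpa using hD) x t
    have h2 : ‖sourceKer r q (fun _ _ => 0) x t‖ ≤ μ x := by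
      unfold sourceKer cutTriangle
      split_ifs
      · simpa using hqμ x t
      · simpa using h0
    have h3 : Real.exp (l * x) ≤ Real.exp (l * r) := by gcongr
    calc ‖sourceKer r q y x t‖ ≤ _ := norm_le_norm_sub_add _ (sourceKer r q (fun _ _ => 0) x t)
      _ ≤ r * D * (μ x * Real.exp (l * r)) + μ x := by
        refine add_le_add (h1.trans ?_) h2
        gcongr
      _ = _ := by ring
  · have : sourceKer r q y x t = 0 := by simp [sourceKer, cutTriangle, hx]
    rw [this, norm_zero]; positivity

/-- D'Alembert's formula with source `m`. With `z = y + p`, `z + w` is the integral of `m` along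
lines of slope 1, `z - w` along lines of slope -1, and `p` along horizontal ones; hence `y = z - p`
is the stated combination. The cut-off of `m` imposes zero data for `z + w` at `t = 0` and for `z -
w` on the diagonal. -/
theorem exists_kernel_fixedPoint [CompleteSpace 𝔸] {r : ℝ} (hr : 0 < r) {q : ℝ → ℝ → 𝔸}
    (hq : StronglyMeasurable (Function.uncurry q)) {μ : ℝ → ℝ}
    (hμ : MemLp μ 2 (volume.restrict (Ioo 0 r))) (hqμ : ∀ x t, ‖q x t‖ ≤ μ x) :
    ∃ y m : ℝ → ℝ → 𝔸, StronglyMeasurable (Function.uncurry y) ∧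
      (∃ C, ∀ x t, ‖y x t‖ ≤ C) ∧ StronglyMeasurable (Function.uncurry m) ∧
      (∃ κ : ℝ → ℝ, IntegrableOn κ (Ioo 0 r) ∧ ∀ s τ, ‖m s τ‖ ≤ κ s) ∧
      m = sourceKer r q y ∧
      y = cutTriangle r fun x t => (2⁻¹ : ℝ) • lineInt r (-1) m x t +
        (2⁻¹ : ℝ) • lineInt r 1 m x t - lineInt r 0 m x t := by
  -- The weights 1/2, 1/2, 1 of the three line integrals add up to 2 and the source contributes a
  -- factor `r`, so the contraction needs `2 r ε ≤ 1/2`.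
  obtain ⟨l, hl, hlx⟩ := exists_exp_weight hμ (ε := 1 / (4 * (r + 1))) (by positivity)
  have hμ1 : IntegrableOn μ (Ioo 0 r) := hμ.integrable (by norm_num)
  have hμ0 : ∀ x, 0 ≤ μ x := fun x => (norm_nonneg _).trans (hqμ x 0)
  set S : (ℝ → ℝ → 𝔸) → ℝ → ℝ → 𝔸 := fun m => cutTriangle r fun x t =>
    (2⁻¹ : ℝ) • lineInt r (-1) m x t + (2⁻¹ : ℝ) • lineInt r 1 m x t - lineInt r 0 m x t with hS
  have hSm : ∀ m, StronglyMeasurable (Function.uncurry m) →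
      StronglyMeasurable (Function.uncurry (S m)) := fun m hm =>
    stronglyMeasurable_cutTriangle ((((stronglyMeasurable_lineInt hm).const_smul _).add
      ((stronglyMeasurable_lineInt hm).const_smul _)).sub (stronglyMeasurable_lineInt hm))
  have half : ∀ {a b c : 𝔸} {B : ℝ}, ‖a‖ ≤ B → ‖b‖ ≤ B → ‖c‖ ≤ B →
      ‖(2⁻¹ : ℝ) • a + (2⁻¹ : ℝ) • b - c‖ ≤ 2 * B := by
    intro a b c B ha hb hc
    refine (norm_sub_le _ _).trans ((add_le_add_left (norm_add_le _ _) _).trans ?_)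
    rw [norm_smul, norm_smul, Real.norm_of_nonneg (by norm_num)]
    linarith
  refine (exists_measurable_fixedPoint (E := 𝔸)
    (fun p : ℝ × ℝ => Real.exp (l * p.1))
    (fun g => Function.uncurry (S (sourceKer r q (Function.curry g)))) ?_ ?_).elim ?_
  rotate_left 2
  · rintro g ⟨hgm, ⟨D, hD⟩, hg⟩
    have hgm' : StronglyMeasurable (Function.uncurry (Function.curry g)) := by simpa using hgm
    have hD' : ∀ x t, ‖Function.curry g x t‖ ≤ D * Real.exp (l * x) := fun x t => hD (x, t)
    have hm := stronglyMeasurable_sourceKer (r := r) hq hgm'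
    have hyg : S (sourceKer r q (Function.curry g)) = Function.curry g := by
      funext x t; exact congrFun hg (x, t)
    have hb := norm_sourceKer_le hr.le hq hgm' hqμ hl hD'
    refine ⟨Function.curry g, sourceKer r q (Function.curry g), hgm', ?_, hm,
      ⟨_, hμ1.const_mul _, hb⟩, rfl, hyg.symm⟩
    have hL := fun a => norm_lineInt_le (a := a) (hμ1.const_mul _) hb
    refine ⟨2 * ∫ s in Ioo 0 r, (1 + r * D * Real.exp (l * r)) * μ s, fun x t => ?_⟩
    rw [← congrFun (congrFun hyg x) t]
    simp only [hS, cutTriangle]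
    split_ifs
    · exact half (hL _ x t) (hL _ x t) (hL _ x t)
    · exact norm_zero.trans_le (mul_nonneg zero_le_two ((norm_nonneg _).trans (hL 0 x t)))
  · rintro g hgm ⟨D, hD⟩
    have hgm' : StronglyMeasurable (Function.uncurry (Function.curry g)) := by simpa using hgm
    have hD' : ∀ x t, ‖Function.curry g x t‖ ≤ D * Real.exp (l * x) := fun x t => hD (x, t)
    have hm := stronglyMeasurable_sourceKer (r := r) hq hgm'
    have hb := norm_sourceKer_le hr.le hq hgm' hqμ hl hD'
    refine ⟨hSm _ hm, ?_⟩
    have hL := fun a => norm_lineInt_le (a := a) (hμ1.const_mul _) hb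
    refine ⟨2 * ∫ s in Ioo 0 r, (1 + r * D * Real.exp (l * r)) * μ s, fun p => ?_⟩
    have h0 := mul_nonneg zero_le_two ((norm_nonneg _).trans (hL 0 p.1 p.2))
    simp only [Function.uncurry, hS, cutTriangle]
    split_ifs with h
    · refine (half (hL _ p.1 p.2) (hL _ p.1 p.2) (hL _ p.1 p.2)).trans ?_
      exact le_mul_of_one_le_right h0 (Real.one_le_exp (mul_nonneg hl (h.1.trans h.2.1)))
    · rw [norm_zero]; positivity
  · rintro g g' hgm ⟨D₁, hD₁⟩ hgm' ⟨D₂, hD₂⟩ D hD p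
    have hm1 : StronglyMeasurable (Function.uncurry (Function.curry g)) := by simpa using hgm
    have hm2 : StronglyMeasurable (Function.uncurry (Function.curry g')) := by simpa using hgm'
    have b1 : ∀ x t, ‖Function.curry g x t‖ ≤ D₁ * Real.exp (l * x) := fun x t => hD₁ (x, t)
    have b2 : ∀ x t, ‖Function.curry g' x t‖ ≤ D₂ * Real.exp (l * x) := fun x t => hD₂ (x, t)
    have hD0 : 0 ≤ D := by
      have := (norm_nonneg _).trans (hD (0, 0)); simpa using this
    have hν : IntegrableOn (fun s => r * D * (μ s * Real.exp (l * s))) (Ioo 0 r) := by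
      refine Integrable.const_mul ?_ _
      have hc : Continuous fun s => Real.exp (l * s) := by fun_prop
      exact (((integrableOn_Icc_iff_integrableOn_Ioo).2 hμ1).mul_continuousOn hc.continuousOn
        isCompact_Icc).mono_set Ioo_subset_Icc_self
    have hL := fun a => norm_lineInt_sub_le (a := a) (stronglyMeasurable_sourceKer (r := r) hq hm1)
      (stronglyMeasurable_sourceKer (r := r) hq hm2) (hμ1.const_mul _)
      (norm_sourceKer_le hr.le hq hm1 hqμ hl b1) (hμ1.const_mul _)
      (norm_sourceKer_le hr.le hq hm2 hqμ hl b2) hν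
      (norm_sourceKer_sub_le hr.le hq hm1 hm2 hqμ hl b1 b2 (fun x t => hD (x, t)))
    simp only [Function.uncurry, hS, cutTriangle]
    split_ifs with h
    · have e : ∀ a b c a' b' c' : 𝔸, (2⁻¹ : ℝ) • a + (2⁻¹ : ℝ) • b - c -
          ((2⁻¹ : ℝ) • a' + (2⁻¹ : ℝ) • b' - c') =
          (2⁻¹ : ℝ) • (a - a') + (2⁻¹ : ℝ) • (b - b') - (c - c') := by
        intros; simp only [smul_sub]; abel
      rw [e]
      refine (half (hL _ p.1 p.2) (hL _ p.1 p.2) (hL _ p.1 p.2)).trans ?_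
      have hw := hlx p.1 ⟨h.1.trans h.2.1, h.2.2⟩
      have e2 : ∫ s in Ioo 0 r, (if s ≤ p.1 then r * D * (μ s * Real.exp (l * s)) else 0) =
          r * D * ∫ s in Ioo 0 r, (if s ≤ p.1 then |μ s| * Real.exp (l * s) else 0) := by
        rw [← integral_const_mul]
        congr 1; funext s
        rw [abs_of_nonneg (hμ0 s)]; split_ifs <;> simp
      rw [e2]
      have hX := Real.exp_pos (l * p.1)
      calc 2 * (r * D * _) ≤ 2 * (r * D * (1 / (4 * (r + 1)) * Real.exp (l * p.1))) := by gcongr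
        _ = (r / (r + 1)) * (D / 2 * Real.exp (l * p.1)) := by field_simp; ring
        _ ≤ 1 * (D / 2 * Real.exp (l * p.1)) := by
          gcongr
          rw [div_le_one (by positivity)]; linarith
        _ = _ := one_mul _
    · rw [sub_zero, norm_zero]; positivity

end VolterraKernels


/-! ### From line integrals to the intertwining relations -/

section Transmutation

open Filter Topology

theorem intervalIntegrable_of_bounded {E : Type*} [NormedAddCommGroup E] {f : ℝ → E}
    (hf : StronglyMeasurable f) {C : ℝ} (hC : ∀ s, ‖f s‖ ≤ C) (a b : ℝ) :
    IntervalIntegrable f volume a b := by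
  rw [intervalIntegrable_iff]
  exact Measure.integrableOn_of_bounded (M := C) (by simp) hf.aestronglyMeasurable
    (Eventually.of_forall hC)

variable {𝔸 : Type*} [NormedRing 𝔸] [NormedAlgebra ℝ 𝔸]

/-- The contribution of a single source column `x'`. By substitution the first term is the integral
of `f` from `t + a(x - x')` to `x + a(x - x')` and the second the one from `t` to `t + a(x - x')`.
They join up, and the piece between `x` and `x + a(x - x')` lies above `x'`, where `f` vanishes. -/
theorem line_integral_add_eq {r a x t : ℝ} (ha : |a| ≤ 1) (ht : 0 ≤ t) (htx : t ≤ x) (hxr : x ≤ r)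
    {f : ℝ → 𝔸} {x' : ℝ} (hx' : 0 ≤ x') (hf : ∀ τ, x' < τ → f τ = 0)
    (hfi : ∀ a b, IntervalIntegrable f volume a b) :
    (∫ s in Ioo 0 r, if t ≤ s ∧ s ≤ x then (if x' ≤ x then f (s + a * (x - x')) else 0) else 0) +
      a • (∫ s in Ioo 0 r, if t ≤ s ∧ s ≤ x then (if x' ≤ s then f (t + a * (s - x')) else 0)
        else 0) = if x' ≤ x then ∫ τ in t..x, f τ else 0 := by
  -- The condition `t ≤ s` can be dropped from the second integral: for `x' ≤ s < t` the point `t +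
  -- a(s - x')` already exceeds `x'`, since `a ≥ -1`.
  obtain ⟨ha1, ha2⟩ := abs_le.1 ha
  have e : ∀ s, (if t ≤ s ∧ s ≤ x then (if x' ≤ s then f (t + a * (s - x')) else 0) else 0) =
      if x' ≤ s ∧ s ≤ x then f (t + a * (s - x')) else 0 := by
    intro s
    by_cases h1 : t ≤ s <;> by_cases h2 : s ≤ x <;> by_cases h3 : x' ≤ s <;> simp [h1, h2, h3]
    exact (hf _ (by nlinarith)).symm
  simp only [e]
  by_cases hx : x' ≤ x
  · simp only [hx, if_true]
    rw [setIntegral_ite_le_le ht htx hxr, setIntegral_ite_le_le hx' hx hxr,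
      intervalIntegral.integral_comp_add_right]
    have e2 : a • ∫ s in x'..x, f (t + a * (s - x')) = ∫ τ in t..t + a * (x - x'), f τ := by
      have := intervalIntegral.smul_integral_comp_mul_add (a := x') (b := x) f a (t - a * x')
      have h3 : ∀ s, a * s + (t - a * x') = t + a * (s - x') := fun s => by ring
      simp only [h3] at this
      rw [this]; simp
    rw [e2, add_comm, intervalIntegral.integral_add_adjacent_intervals (hfi _ _) (hfi _ _),
      ← intervalIntegral.integral_add_adjacent_intervals (hfi t x) (hfi x _)]
    conv_rhs => rw [← add_zero (∫ τ in t..x, f τ)]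
    congr 1
    rw [intervalIntegral.integral_congr_ae (g := fun _ => 0)]
    · simp
    · refine Eventually.of_forall fun τ hτ => hf τ ?_
      have h4 : x' ≤ min x (x + a * (x - x')) := le_min hx (by nlinarith)
      exact h4.trans_lt hτ.1
  · have h5 : ∀ s, ¬ (x' ≤ s ∧ s ≤ x) := fun s h => hx (h.1.trans h.2)
    simp [hx, h5]

/-- The integrated form of `(∂_x - a ∂_t) L = m` for `L = lineInt r a m`, which needs no smoothness
of `m`. The right side does not depend on `a`; this is what links the three families of lines. -/
theorem integral_lineInt_add {r a x t : ℝ} (ha : |a| ≤ 1) (ht : 0 ≤ t) (htx : t ≤ x) (hxr : x ≤ r)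
    {m : ℝ → ℝ → 𝔸} (hm : StronglyMeasurable (Function.uncurry m)) {κ : ℝ → ℝ}
    (hκ : IntegrableOn κ (Ioo 0 r)) (hmκ : ∀ s τ, ‖m s τ‖ ≤ κ s) (hm0 : ∀ s τ, s < τ → m s τ = 0) :
    (∫ s in t..x, lineInt r a m x s) + a • (∫ s in t..x, lineInt r a m s t) =
      ∫ s in Ioo 0 r, if s ≤ x then ∫ τ in t..x, m s τ else 0 := by
  set ν := (volume : Measure ℝ).restrict (Ioo 0 r) with hν
  have hκ0 : ∀ s, 0 ≤ κ s := fun s => (norm_nonneg _).trans (hmκ s 0)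
  have hS : MeasurableSet {p : ℝ × ℝ | t ≤ p.1 ∧ p.1 ≤ x} :=
    MeasurableSet.inter (s₁ := {p : ℝ × ℝ | t ≤ p.1}) (s₂ := {p | p.1 ≤ x})
      (measurableSet_le (by fun_prop) (by fun_prop)) (measurableSet_le (by fun_prop) (by fun_prop))
  have hint : ∀ (c : ℝ → ℝ) (d : ℝ → ℝ → ℝ), Measurable c → Measurable (Function.uncurry d) →
      Integrable (fun p : ℝ × ℝ => if t ≤ p.1 ∧ p.1 ≤ x then
        (if p.2 ≤ c p.1 then m p.2 (d p.1 p.2) else 0) else 0) (ν.prod ν) := by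
    intro c d hc hd
    refine Integrable.mono' (Integrable.comp_snd hκ ν) ?_ (Eventually.of_forall fun p => ?_)
    · refine (StronglyMeasurable.ite hS (StronglyMeasurable.ite
        (measurableSet_le measurable_snd (hc.comp measurable_fst)) ?_ stronglyMeasurable_const)
        stronglyMeasurable_const).aestronglyMeasurable
      exact hm.comp_measurable (g := fun p : ℝ × ℝ => (p.2, d p.1 p.2))
        (measurable_snd.prodMk hd)
    · split_ifs
      · exact hmκ _ _
      · simpa using hκ0 _
      · simpa using hκ0 _
  have hd1 : Measurable (Function.uncurry fun s x' : ℝ => s + a * (x - x')) := by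
    unfold Function.uncurry; fun_prop
  have hd2 : Measurable (Function.uncurry fun s x' : ℝ => t + a * (s - x')) := by
    unfold Function.uncurry; fun_prop
  have i1 := hint (fun _ => x) _ measurable_const hd1
  have i2 := hint (fun s => s) _ measurable_id hd2
  have e1 : ∫ s in t..x, lineInt r a m x s = ∫ s, ∫ x', (if t ≤ s ∧ s ≤ x then
      (if x' ≤ x then m x' (s + a * (x - x')) else 0) else 0) ∂ν ∂ν := by
    rw [← setIntegral_ite_le_le ht htx hxr]
    refine integral_congr_ae (Eventually.of_forall fun s => ?_)
    simp only [lineInt]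
    split_ifs <;> simp [hν]
  have e2 : ∫ s in t..x, lineInt r a m s t = ∫ s, ∫ x', (if t ≤ s ∧ s ≤ x then
      (if x' ≤ s then m x' (t + a * (s - x')) else 0) else 0) ∂ν ∂ν := by
    rw [← setIntegral_ite_le_le ht htx hxr]
    refine integral_congr_ae (Eventually.of_forall fun s => ?_)
    simp only [lineInt]
    split_ifs <;> simp [hν]
  have j1 : Integrable (fun x' => ∫ s, (if t ≤ s ∧ s ≤ x then
      (if x' ≤ x then m x' (s + a * (x - x')) else 0) else 0) ∂ν) ν := i1.integral_prod_right
  have j2 : Integrable (fun x' => a • ∫ s, (if t ≤ s ∧ s ≤ x then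
      (if x' ≤ s then m x' (t + a * (s - x')) else 0) else 0) ∂ν) ν :=
    i2.integral_prod_right.smul a
  rw [e1, e2, integral_integral_swap (f := fun s x' => if t ≤ s ∧ s ≤ x then
      (if x' ≤ x then m x' (s + a * (x - x')) else 0) else 0) i1,
    integral_integral_swap (f := fun s x' => if t ≤ s ∧ s ≤ x then
      (if x' ≤ s then m x' (t + a * (s - x')) else 0) else 0) i2, ← integral_smul,
    ← integral_add j1 j2]
  refine integral_congr_ae ?_
  filter_upwards [ae_restrict_mem measurableSet_Ioo] with x' hx'
  exact line_integral_add_eq ha ht htx hxr hx'.1.le (hm0 x')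
    (intervalIntegrable_of_bounded (hm.comp_measurable measurable_prodMk_left) (hmκ x'))

omit [NormedAlgebra ℝ 𝔸] in
theorem cutTriangle_of_le {r x t : ℝ} (ht : 0 ≤ t) (htx : t ≤ x) (hxr : x ≤ r) (k : ℝ → ℝ → 𝔸) :
    cutTriangle r k x t = k x t := by
  simp [cutTriangle, ht, htx, hxr]

omit [NormedAlgebra ℝ 𝔸] in
theorem cutTriangle_of_lt {r x t : ℝ} (h : x < t) (k : ℝ → ℝ → 𝔸) :
    cutTriangle r k x t = 0 := by
  simp [cutTriangle, not_le.2 h]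

omit [NormedAlgebra ℝ 𝔸] in
theorem norm_cutTriangle_le {r : ℝ} {k : ℝ → ℝ → 𝔸} {C : ℝ}
    (hk : ∀ x t, ‖k x t‖ ≤ C) (x t : ℝ) :
    ‖cutTriangle r k x t‖ ≤ C := by
  unfold cutTriangle
  split_ifs
  · exact hk x t
  · rw [norm_zero]; exact (norm_nonneg _).trans (hk x t)

/-- Kernels of the Volterra operators intertwining the first order systems attached to `J²` and to
`J (1 + J Q) J`, where `J` is the integration operator and `Q` has kernel `q`. -/
theorem exists_intertwining_kernels [CompleteSpace 𝔸] {r : ℝ} (hr : 0 < r) {q : ℝ → ℝ → 𝔸}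
    (hq : StronglyMeasurable (Function.uncurry q)) {μ : ℝ → ℝ}
    (hμ : MemLp μ 2 (volume.restrict (Ioo 0 r))) (hqμ : ∀ x t, ‖q x t‖ ≤ μ x) :
    ∃ y w p : ℝ → ℝ → 𝔸,
      (StronglyMeasurable (Function.uncurry y) ∧ ∃ C, ∀ x t, ‖y x t‖ ≤ C) ∧
      (StronglyMeasurable (Function.uncurry w) ∧ ∃ C, ∀ x t, ‖w x t‖ ≤ C) ∧
      (StronglyMeasurable (Function.uncurry p) ∧ ∃ C, ∀ x t, ‖p x t‖ ≤ C) ∧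
      (∀ x t, x < t → y x t = 0) ∧ (∀ x t, x < t → w x t = 0) ∧ (∀ x t, x < t → p x t = 0) ∧
      ∀ x t, 0 ≤ t → t ≤ x → x ≤ r →
        ((∫ s in t..x, w x s) = ∫ s in t..x, (y s t + p s t)) ∧
        ((∫ s in t..x, y x s) = ∫ s in t..x, w s t) ∧
        p x t = (∫ s in t..x, q s t) + ∫ τ in t..x, (∫ s in τ..x, q s τ) * y τ t := by
  obtain ⟨y, m, hy, ⟨C, hC⟩, hm, ⟨κ, hκ, hmκ⟩, hmy, hym⟩ := exists_kernel_fixedPoint hr hq hμ hqμ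
  have hm0 : ∀ s τ, s < τ → m s τ = 0 := fun s τ h => by
    rw [hmy]; exact cutTriangle_of_lt h _
  have hLm : ∀ a, StronglyMeasurable (Function.uncurry (lineInt r a m)) := fun a =>
    stronglyMeasurable_lineInt hm
  set B := ∫ s in Ioo 0 r, κ s with hB
  have hLb : ∀ a x t, ‖lineInt r a m x t‖ ≤ B := fun a x t => norm_lineInt_le hκ hmκ x t
  have hLi1 : ∀ a x b c, IntervalIntegrable (fun s => lineInt r a m x s) volume b c :=
    fun a x b c => intervalIntegrable_of_bounded
      ((hLm a).comp_measurable measurable_prodMk_left) (hLb a x) b c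
  have hLi2 : ∀ a t b c, IntervalIntegrable (fun s => lineInt r a m s t) volume b c :=
    fun a t b c => intervalIntegrable_of_bounded
      ((hLm a).comp_measurable measurable_prodMk_right) (fun s => hLb a s t) b c
  have hLs1 : ∀ a x b c, IntervalIntegrable (fun s => (2⁻¹ : ℝ) • lineInt r a m x s) volume b c :=
    fun a x b c => (hLi1 a x b c).smul (2⁻¹ : ℝ)
  have hLs2 : ∀ a t b c, IntervalIntegrable (fun s => (2⁻¹ : ℝ) • lineInt r a m s t) volume b c :=
    fun a t b c => (hLi2 a t b c).smul (2⁻¹ : ℝ)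
  -- Here `w` is half the difference of `z + w` and `z - w`, and `p` is the primitive of `m` in `x`,
  -- that is the case `a = 0`.
  refine ⟨y, cutTriangle r fun x t => (2⁻¹ : ℝ) • lineInt r (-1) m x t -
    (2⁻¹ : ℝ) • lineInt r 1 m x t, cutTriangle r (lineInt r 0 m), ⟨hy, C, hC⟩,
    ⟨stronglyMeasurable_cutTriangle (((hLm _).const_smul _).sub ((hLm _).const_smul _)), B,
      norm_cutTriangle_le fun x t => ?_⟩,
    ⟨stronglyMeasurable_cutTriangle (hLm 0), B, norm_cutTriangle_le (hLb 0)⟩,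
    fun x t h => ?_, fun x t h => cutTriangle_of_lt h _, fun x t h => cutTriangle_of_lt h _, ?_⟩
  · refine (norm_sub_le _ _).trans ?_
    rw [norm_smul, norm_smul, Real.norm_of_nonneg (by norm_num)]
    linarith [hLb (-1) x t, hLb 1 x t]
  · rw [hym]; exact cutTriangle_of_lt h _
  intro x t ht htx hxr
  -- The cases `a = -1, 1, 0` share the right side `I`; eliminating it proves the first two
  -- relations by linear algebra.
  have hid := fun a (ha : |a| ≤ 1) => integral_lineInt_add ha ht htx hxr hm hκ hmκ hm0
  have d1 := hid (-1) (by norm_num)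
  have d2 := hid 1 (by norm_num)
  have d3 := hid 0 (by norm_num)
  set I := ∫ s in Ioo 0 r, if s ≤ x then ∫ τ in t..x, m s τ else 0
  have cx : ∀ k : ℝ → ℝ → 𝔸, ∫ s in t..x, cutTriangle r k x s = ∫ s in t..x, k x s := fun k =>
    intervalIntegral.integral_congr fun s hs => by
      rw [uIcc_of_le htx] at hs
      exact cutTriangle_of_le (ht.trans hs.1) hs.2 hxr _
  have ct : ∀ k : ℝ → ℝ → 𝔸, ∫ s in t..x, cutTriangle r k s t = ∫ s in t..x, k s t := fun k =>
    intervalIntegral.integral_congr fun s hs => by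
      rw [uIcc_of_le htx] at hs
      exact cutTriangle_of_le ht hs.1 (hs.2.trans hxr) _
  refine ⟨?_, ?_, ?_⟩
  · have e : ∫ s in t..x, (y s t + cutTriangle r (lineInt r 0 m) s t) =
        ∫ s in t..x, ((2⁻¹ : ℝ) • lineInt r (-1) m s t + (2⁻¹ : ℝ) • lineInt r 1 m s t) :=
      intervalIntegral.integral_congr fun s hs => by
        rw [uIcc_of_le htx] at hs
        simp only [hym]
        rw [cutTriangle_of_le ht hs.1 (hs.2.trans hxr), cutTriangle_of_le ht hs.1 (hs.2.trans hxr)]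
        abel
    rw [e, cx, intervalIntegral.integral_sub (hLs1 _ _ _ _) (hLs1 _ _ _ _),
      intervalIntegral.integral_add (hLs2 _ _ _ _) (hLs2 _ _ _ _)]
    simp only [intervalIntegral.integral_smul]
    rw [neg_one_smul, ← sub_eq_add_neg, sub_eq_iff_eq_add] at d1
    rw [one_smul, ← eq_sub_iff_add_eq] at d2
    rw [d1, d2]
    module
  · rw [hym, cx, ct, intervalIntegral.integral_sub ((hLs1 _ _ _ _).add
      (hLs1 _ _ _ _)) (hLi1 _ _ _ _),
      intervalIntegral.integral_add (hLs1 _ _ _ _) (hLs1 _ _ _ _),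
      intervalIntegral.integral_sub (hLs2 _ _ _ _) (hLs2 _ _ _ _)]
    simp only [intervalIntegral.integral_smul]
    rw [neg_one_smul, ← sub_eq_add_neg, sub_eq_iff_eq_add] at d1
    rw [one_smul, ← eq_sub_iff_add_eq] at d2
    rw [zero_smul, add_zero] at d3
    rw [d1, d2, d3]
    module
  · rw [cutTriangle_of_le ht htx hxr]
    have hμ1 : IntegrableOn μ (Ioo 0 r) := hμ.integrable (by norm_num)
    have hμi : ∀ c d, 0 ≤ c → c ≤ d → d ≤ r → IntegrableOn μ (Ioc c d) := fun c d h1 h2 h3 => by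
      rw [integrableOn_Ioc_iff_integrableOn_Ioo]
      exact hμ1.mono_set (Ioo_subset_Ioo h1 h3)
    have hC0 : 0 ≤ C := (norm_nonneg _).trans (hC 0 0)
    have hF : Integrable (Function.uncurry fun s τ => q s τ * y τ t)
        ((volume.restrict (Ioc t x)).prod (volume.restrict (Ioc t x))) := by
      refine Integrable.mono' (Integrable.comp_fst ((hμi t x ht htx hxr).mul_const C) _) ?_
        (Eventually.of_forall fun z => ?_)
      · exact (hq.mul (hy.comp_measurable (g := fun z : ℝ × ℝ => (z.2, t))
          (by fun_prop))).aestronglyMeasurable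
      · exact (norm_mul_le _ _).trans (mul_le_mul (hqμ _ _) (hC _ _) (norm_nonneg _)
          ((norm_nonneg _).trans (hqμ z.1 0)))
    have hqi : ∀ τ c, 0 ≤ c → c ≤ x → IntervalIntegrable (fun s => q s τ) volume c x := by
      intro τ c h1 h2
      rw [intervalIntegrable_iff_integrableOn_Ioc_of_le h2]
      exact Integrable.mono' (hμi c x h1 h2 hxr)
        (hq.comp_measurable measurable_prodMk_right).aestronglyMeasurable
        (Eventually.of_forall fun s => hqμ s τ)
    -- On the horizontal line, `m` is replaced by `q + q ⋆ y`; exchanging the order of integration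
    -- then puts the primitive of `q` in front of `y`.
    have e1 : lineInt r 0 m x t = ∫ s in t..x, (q s t + ∫ τ in t..s, q s τ * y τ t) := by
      rw [← setIntegral_ite_le_le ht htx hxr, lineInt]
      refine setIntegral_congr_fun measurableSet_Ioo fun s hs => ?_
      simp only [zero_mul, add_zero, hmy, sourceKer, cutTriangle, ht, true_and, hs.2.le, and_true]
      by_cases h1 : s ≤ x <;> by_cases h2 : t ≤ s <;> simp only [h1, h2, if_true, if_false, and_true, and_false]
      rw [setIntegral_ite_le_le ht h2 hs.2.le]
    have hgi : IntervalIntegrable (fun s => ∫ τ in t..s, q s τ * y τ t) volume t x := by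
      have hS : MeasurableSet {p : ℝ × ℝ | p.2 ≤ p.1} :=
        measurableSet_le measurable_snd measurable_fst
      rw [intervalIntegrable_iff_integrableOn_Ioc_of_le htx]
      refine ((hF.indicator hS).integral_prod_left).congr ?_
      filter_upwards [ae_restrict_mem measurableSet_Ioc] with s hs
      rw [intervalIntegral.integral_of_le hs.1.le, ← min_eq_right hs.2, ← Ioc_inter_Iic,
        ← setIntegral_indicator measurableSet_Iic]
      simp [indicator, Function.uncurry, min_eq_right hs.2]
    rw [e1, intervalIntegral.integral_add (hqi t t ht htx) hgi, integral_triangle_swap htx hF]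
    congr 1
    refine intervalIntegral.integral_congr fun τ hτ => ?_
    rw [uIcc_of_le htx] at hτ
    have := hqi τ τ (ht.trans hτ.1) hτ.2
    rw [intervalIntegrable_iff_integrableOn_Ioc_of_le hτ.2] at this
    simp only [intervalIntegral.integral_of_le hτ.2]
    exact integral_mul_const_of_integrable this

end Transmutation


/-! ### Volterra operators with bounded kernels and their inverses -/

section IntegralOperators

open Filter Topology

/-- The equation is `g = -w - w ⋆ g` on the triangle. No smallness of `w` is needed: a fast enough
exponential weight makes the Volterra convolution a contraction. It serves both to invert `1 + W`
and to solve a linear differential equation. -/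
theorem exists_resolvent_kernel {𝔸 : Type*} [NormedRing 𝔸] [NormedAlgebra ℝ 𝔸] [CompleteSpace 𝔸]
    {r : ℝ} (hr : 0 < r) {w : ℝ → ℝ → 𝔸} (hw : StronglyMeasurable (Function.uncurry w)) {C : ℝ}
    (hC : ∀ x t, ‖w x t‖ ≤ C) :
    ∃ g : ℝ → ℝ → 𝔸, StronglyMeasurable (Function.uncurry g) ∧ (∃ D, ∀ x t, ‖g x t‖ ≤ D) ∧
      g = sourceKer r (fun x t => -w x t) g := by
  have hC0 : 0 ≤ C := (norm_nonneg _).trans (hC 0 0)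
  have hw' : StronglyMeasurable (Function.uncurry fun x t => -w x t) := hw.neg
  have hC' : ∀ x t, ‖-w x t‖ ≤ C := fun x t => (norm_neg _).trans_le (hC x t)
  obtain ⟨l, hl, hlx⟩ := exists_exp_weight (r := r) (μ := fun _ => C) (memLp_const C)
    (ε := 1 / 2) (by norm_num)
  refine (exists_measurable_fixedPoint (E := 𝔸) (fun p : ℝ × ℝ => Real.exp (l * p.1))
    (fun g => Function.uncurry (sourceKer r (fun x t => -w x t) (Function.curry g))) ?_ ?_).elim ?_
  rotate_left 2
  · rintro g ⟨hgm, ⟨D, hD⟩, hg⟩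
    have hgm' : StronglyMeasurable (Function.uncurry (Function.curry g)) := by simpa using hgm
    have hD' : ∀ x t, ‖Function.curry g x t‖ ≤ D * Real.exp (l * x) := fun x t => hD (x, t)
    have hyg : sourceKer r (fun x t => -w x t) (Function.curry g) = Function.curry g := by
      funext x t; exact congrFun hg (x, t)
    refine ⟨Function.curry g, hgm', ⟨(1 + r * D * Real.exp (l * r)) * C, fun x t => ?_⟩, hyg.symm⟩
    rw [← congrFun (congrFun hyg x) t]
    exact norm_sourceKer_le (μ := fun _ => C) hr.le hw' hgm' hC' hl hD' x t
  · rintro g hgm ⟨D, hD⟩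
    have hgm' : StronglyMeasurable (Function.uncurry (Function.curry g)) := by simpa using hgm
    have hD' : ∀ x t, ‖Function.curry g x t‖ ≤ D * Real.exp (l * x) := fun x t => hD (x, t)
    refine ⟨stronglyMeasurable_sourceKer hw' hgm', (1 + r * D * Real.exp (l * r)) * C, fun p => ?_⟩
    have hb := norm_sourceKer_le (μ := fun _ => C) hr.le hw' hgm' hC' hl hD' p.1 p.2
    by_cases h : 0 ≤ p.2 ∧ p.2 ≤ p.1 ∧ p.1 ≤ r
    · exact hb.trans (le_mul_of_one_le_right ((norm_nonneg _).trans hb)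
        (Real.one_le_exp (mul_nonneg hl (h.1.trans h.2.1))))
    · simp only [Function.uncurry, sourceKer, cutTriangle, h, if_false, norm_zero]
      exact mul_nonneg ((norm_nonneg _).trans hb) (Real.exp_pos _).le
  · rintro g g' hgm ⟨D₁, hD₁⟩ hgm' ⟨D₂, hD₂⟩ D hD p
    have hm1 : StronglyMeasurable (Function.uncurry (Function.curry g)) := by simpa using hgm
    have hm2 : StronglyMeasurable (Function.uncurry (Function.curry g')) := by simpa using hgm'
    have b1 : ∀ x t, ‖Function.curry g x t‖ ≤ D₁ * Real.exp (l * x) := fun x t => hD₁ (x, t)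
    have b2 : ∀ x t, ‖Function.curry g' x t‖ ≤ D₂ * Real.exp (l * x) := fun x t => hD₂ (x, t)
    have hD0 : 0 ≤ D := by
      have := (norm_nonneg _).trans (hD (0, 0)); simpa using this
    simp only [Function.uncurry, sourceKer, cutTriangle]
    split_ifs with h
    · rw [add_sub_add_left_eq_sub, ← integral_sub
        (integrable_mul_section (μ := fun _ => C) hw' hm1 hC' hl b1 p.1 p.2)
        (integrable_mul_section (μ := fun _ => C) hw' hm2 hC' hl b2 p.1 p.2)]
      have hi : Integrable (fun s => if s ≤ p.1 then |C| * Real.exp (l * s) else 0)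
          (volume.restrict (Ioo 0 r)) := by
        have hc : Continuous fun s => |C| * Real.exp (l * s) := by fun_prop
        have : (fun s => if s ≤ p.1 then |C| * Real.exp (l * s) else 0) =
            (Iic p.1).indicator (fun s => |C| * Real.exp (l * s)) := by
          funext s; simp [indicator]
        rw [this]
        exact Integrable.indicator ((hc.continuousOn.integrableOn_compact
          isCompact_Icc).mono_set Ioo_subset_Icc_self) measurableSet_Iic
      refine (norm_integral_le_of_norm_le (hi.const_mul D)
        (Eventually.of_forall fun s => ?_)).trans ?_
      · by_cases h1 : p.2 ≤ s <;> by_cases h2 : s ≤ p.1 <;>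
          simp only [h1, h2, and_true, if_true, if_false, and_false, sub_zero, norm_zero]
        · rw [← mul_sub, abs_of_nonneg hC0]
          refine (norm_mul_le _ _).trans ((mul_le_mul (hC' _ _) (hD (s, p.2)) (norm_nonneg _)
            hC0).trans (le_of_eq ?_))
          simp only; ring
        · simp
        · positivity
        · simp
      · rw [integral_const_mul]
        have := hlx p.1 ⟨h.1.trans h.2.1, h.2.2⟩
        calc _ ≤ D * (1 / 2 * Real.exp (l * p.1)) := by gcongr
          _ = _ := by ring
    · rw [sub_zero, norm_zero]; positivity

variable {n : ℕ} {r : ℝ}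

/-- Bounded measurable operator-valued kernels. -/
def IsBddKer (k : ℝ → ℝ → EuclideanSpace ℂ (Fin n) →L[ℂ] EuclideanSpace ℂ (Fin n)) : Prop :=
  StronglyMeasurable (Function.uncurry k) ∧ ∃ C, ∀ x t, ‖k x t‖ ≤ C

variable {k l c : ℝ → ℝ → EuclideanSpace ℂ (Fin n) →L[ℂ] EuclideanSpace ℂ (Fin n)}

theorem IsBddKer.add (hk : IsBddKer k) (hl : IsBddKer l) : IsBddKer fun x t => k x t + l x t := by
  obtain ⟨hk, C, hC⟩ := hk
  obtain ⟨hl, D, hD⟩ := hl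
  exact ⟨hk.add hl, C + D, fun x t => (norm_add_le _ _).trans (add_le_add (hC x t) (hD x t))⟩

theorem IsBddKer.neg (hk : IsBddKer k) : IsBddKer fun x t => -k x t := by
  obtain ⟨hk, C, hC⟩ := hk
  exact ⟨hk.neg, C, fun x t => (norm_neg _).trans_le (hC x t)⟩

theorem IsBddKer.integrable_apply (hk : IsBddKer k) {f : ℝ → EuclideanSpace ℂ (Fin n)}
    (hf : IntegrableOn f (Ioo 0 r)) (x : ℝ) : IntegrableOn (fun t => k x t (f t)) (Ioo 0 r) := by
  obtain ⟨hk, C, hC⟩ := hk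
  refine Integrable.mono' (hf.norm.const_mul C) ?_ (Eventually.of_forall fun t => ?_)
  · exact isBoundedBilinearMap_apply.continuous.comp_aestronglyMeasurable
      ((hk.comp_measurable measurable_prodMk_left).aestronglyMeasurable.prodMk
        hf.aestronglyMeasurable)
  · exact (k x t).le_of_opNorm_le (hC x t) (f t)

theorem IsBddKer.aestronglyMeasurable (hk : IsBddKer k) {f : ℝ → EuclideanSpace ℂ (Fin n)}
    (hf : IntegrableOn f (Ioo 0 r)) :
    AEStronglyMeasurable (fun x => ∫ t in Ioo 0 r, k x t (f t)) (volume.restrict (Ioo 0 r)) := by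
  refine AEStronglyMeasurable.integral_prod_right' (f := fun p : ℝ × ℝ => k p.1 p.2 (f p.2)) ?_
  exact isBoundedBilinearMap_apply.continuous.comp_aestronglyMeasurable
    (hk.1.aestronglyMeasurable.prodMk hf.aestronglyMeasurable.comp_snd)

theorem norm_integral_ker_le {C : ℝ} (hC : ∀ x t, ‖k x t‖ ≤ C)
    {f : ℝ → EuclideanSpace ℂ (Fin n)} (hf : IntegrableOn f (Ioo 0 r)) (x : ℝ) :
    ‖∫ t in Ioo 0 r, k x t (f t)‖ ≤ C * ∫ t in Ioo 0 r, ‖f t‖ := by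
  rw [← integral_const_mul]
  exact norm_integral_le_of_norm_le (hf.norm.const_mul C)
    (Eventually.of_forall fun t => (k x t).le_of_opNorm_le (hC x t) (f t))

theorem IsBddKer.memLp (hk : IsBddKer k) {f : ℝ → EuclideanSpace ℂ (Fin n)}
    (hf : IntegrableOn f (Ioo 0 r)) :
    MemLp (fun x => ∫ t in Ioo 0 r, k x t (f t)) 2 (volume.restrict (Ioo 0 r)) := by
  obtain ⟨C, hC⟩ := hk.2
  exact MemLp.of_bound (hk.aestronglyMeasurable hf) _
    (Eventually.of_forall fun x => norm_integral_ker_le hC hf x)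

/-- The integral operator on `L₂^n(0,r)` with a bounded kernel. -/
def IsBddKer.op (r : ℝ) (hk : IsBddKer k) : L2 n r →L[ℂ] L2 n r :=
  LinearMap.mkContinuousOfExistsBound
    { toFun := fun f => (hk.memLp (L2.integrableOn f)).toLp
      map_add' := fun f g => by
        rw [← MemLp.toLp_add]
        refine MemLp.toLp_congr _ _ (Eventually.of_forall fun x => ?_)
        rw [Pi.add_apply, ← integral_add (hk.integrable_apply (L2.integrableOn f) x)
          (hk.integrable_apply (L2.integrableOn g) x)]
        refine integral_congr_ae ?_
        filter_upwards [Lp.coeFn_add f g] with t ht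
        rw [ht, Pi.add_apply, map_add]
      map_smul' := fun c f => by
        rw [RingHom.id_apply, ← MemLp.toLp_const_smul]
        refine MemLp.toLp_congr _ _ (Eventually.of_forall fun x => ?_)
        rw [Pi.smul_apply, ← integral_smul]
        refine integral_congr_ae ?_
        filter_upwards [Lp.coeFn_smul c f] with t ht
        rw [ht, Pi.smul_apply, map_smul] }
    (by
      obtain ⟨C, hC⟩ := hk.2
      have hC0 : 0 ≤ C := (norm_nonneg _).trans (hC 0 0)
      refine ⟨measureUnivNNReal (volume.restrict (Ioo (0 : ℝ) r)) ^ (ENNReal.toReal 2)⁻¹ *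
        (C * ((volume.restrict (Ioo (0 : ℝ) r)) univ ^ (1 / 2 : ℝ)).toReal),
        fun f => (Lp.norm_le_of_ae_bound
        (C := C * (((volume.restrict (Ioo (0 : ℝ) r)) univ ^ (1 / 2 : ℝ)).toReal * ‖f‖))
        (by positivity) ?_).trans (le_of_eq ?_)⟩
      · filter_upwards [(hk.memLp (L2.integrableOn f)).coeFn_toLp] with x hx
        simp only [LinearMap.coe_mk, AddHom.coe_mk]
        rw [hx]
        exact (norm_integral_ker_le hC (L2.integrableOn f) x).trans
          (mul_le_mul_of_nonneg_left (L2.integral_norm_le f) hC0)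
      · ring)

theorem IsBddKer.coeFn_op (hk : IsBddKer k) (f : L2 n r) :
    hk.op r f =ᵐ[volume.restrict (Ioo 0 r)] fun x => ∫ t in Ioo 0 r, k x t (f t) :=
  (hk.memLp (L2.integrableOn f)).coeFn_toLp

theorem IsBddKer.op_add (hk : IsBddKer k) (hl : IsBddKer l) :
    (hk.add hl).op r = hk.op r + hl.op r := by
  ext1 f
  refine Lp.ext ?_
  filter_upwards [hk.coeFn_op f, hl.coeFn_op f, (hk.add hl).coeFn_op f,
    Lp.coeFn_add (hk.op r f) (hl.op r f)] with x h1 h2 h3 h4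
  rw [add_apply, h4, Pi.add_apply, h1, h2, h3,
    ← integral_add (hk.integrable_apply (L2.integrableOn f) x)
      (hl.integrable_apply (L2.integrableOn f) x)]
  rfl

theorem IsBddKer.op_neg (hk : IsBddKer k) : hk.neg.op r = -hk.op r := by
  ext1 f
  refine Lp.ext ?_
  filter_upwards [hk.coeFn_op f, hk.neg.coeFn_op f, Lp.coeFn_neg (hk.op r f)] with x h1 h2 h3
  rw [neg_apply, h3, Pi.neg_apply, h1, h2, ← integral_neg]
  rfl

theorem IsBddKer.coeFn_op_comp (hk : IsBddKer k) (hl : IsBddKer l) (f : L2 n r) :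
    (hk.op r ∘L hl.op r) f =ᵐ[volume.restrict (Ioo 0 r)]
      fun x => ∫ t in Ioo 0 r, (∫ s in Ioo 0 r, k x s * l s t) (f t) := by
  obtain ⟨C, hC⟩ := hk.2
  obtain ⟨D, hD⟩ := hl.2
  have hC0 : 0 ≤ C := (norm_nonneg _).trans (hC 0 0)
  filter_upwards [hk.coeFn_op (hl.op r f)] with x hx
  rw [ContinuousLinearMap.comp_apply, hx]
  have e1 : ∫ s in Ioo 0 r, k x s (hl.op r f s) =
      ∫ s in Ioo 0 r, ∫ t in Ioo 0 r, k x s (l s t (f t)) := by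
    refine integral_congr_ae ?_
    filter_upwards [hl.coeFn_op f] with s hs
    rw [hs, ContinuousLinearMap.integral_comp_comm _ (hl.integrable_apply (L2.integrableOn f) s)]
  have hkx : StronglyMeasurable fun s => k x s := hk.1.comp_measurable measurable_prodMk_left
  have hI : Integrable (Function.uncurry fun s t => k x s (l s t (f t)))
      ((volume.restrict (Ioo 0 r)).prod (volume.restrict (Ioo 0 r))) := by
    refine Integrable.mono' (((L2.integrableOn f).norm.const_mul (C * D)).comp_snd _) ?_
      (Eventually.of_forall fun p => ?_)
    · have h1 : AEStronglyMeasurable (fun p : ℝ × ℝ => l p.1 p.2 (f p.2))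
          ((volume.restrict (Ioo 0 r)).prod (volume.restrict (Ioo 0 r))) :=
        isBoundedBilinearMap_apply.continuous.comp_aestronglyMeasurable
          (hl.1.aestronglyMeasurable.prodMk (L2.integrableOn f).aestronglyMeasurable.comp_snd)
      exact isBoundedBilinearMap_apply.continuous.comp_aestronglyMeasurable
        ((hkx.comp_measurable measurable_fst).aestronglyMeasurable.prodMk h1)
    · refine ((k x p.1).le_of_opNorm_le (hC _ _) _).trans ?_
      rw [mul_assoc]
      gcongr
      exact (l p.1 p.2).le_of_opNorm_le (hD _ _) _
  rw [e1, integral_integral_swap hI]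
  refine integral_congr_ae (Eventually.of_forall fun t => ?_)
  have hi : Integrable (fun s => k x s * l s t) (volume.restrict (Ioo 0 r)) := by
    refine Measure.integrableOn_of_bounded (M := C * D) (by simp)
      (hkx.mul (hl.1.comp_measurable measurable_prodMk_right)).aestronglyMeasurable
      (Eventually.of_forall fun s => ?_)
    exact (norm_mul_le _ _).trans (mul_le_mul (hC _ _) (hD _ _) (norm_nonneg _) hC0)
  simp only
  rw [ContinuousLinearMap.integral_apply hi]
  rfl

theorem IsBddKer.op_comp (hk : IsBddKer k) (hl : IsBddKer l) (hc : IsBddKer c)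
    (h : ∀ x ∈ Ioo 0 r, ∀ t ∈ Ioo 0 r, ∫ s in Ioo 0 r, k x s * l s t = c x t) :
    hk.op r ∘L hl.op r = hc.op r := by
  ext1 f
  refine Lp.ext ?_
  filter_upwards [hk.coeFn_op_comp hl f, hc.coeFn_op f, ae_restrict_mem measurableSet_Ioo]
    with x h1 h2 hx
  rw [h1, h2]
  exact setIntegral_congr_fun measurableSet_Ioo fun t ht => by simp only [h x hx t ht]

/-- For relations such as `W J = J (Y + P)`, where neither composite kernel has a closed form. -/
theorem IsBddKer.op_comp_eq
    {k' l' : ℝ → ℝ → EuclideanSpace ℂ (Fin n) →L[ℂ] EuclideanSpace ℂ (Fin n)}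
    (hk : IsBddKer k) (hl : IsBddKer l) (hk' : IsBddKer k') (hl' : IsBddKer l')
    (h : ∀ x ∈ Ioo 0 r, ∀ t ∈ Ioo 0 r,
      ∫ s in Ioo 0 r, k x s * l s t = ∫ s in Ioo 0 r, k' x s * l' s t) :
    hk.op r ∘L hl.op r = hk'.op r ∘L hl'.op r := by
  ext1 f
  refine Lp.ext ?_
  filter_upwards [hk.coeFn_op_comp hl f, hk'.coeFn_op_comp hl' f,
    ae_restrict_mem measurableSet_Ioo] with x h1 h2 hx
  rw [h1, h2]
  exact setIntegral_congr_fun measurableSet_Ioo fun t ht => by simp only [h x hx t ht]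

/-- The identity plus a Volterra operator with bounded kernel has a right inverse of the same
form. -/
theorem IsBddKer.exists_right_inverse (hr : 0 < r) (hk : IsBddKer k)
    (hk0 : ∀ x t, x < t → k x t = 0) :
    ∃ (g : ℝ → ℝ → EuclideanSpace ℂ (Fin n) →L[ℂ] EuclideanSpace ℂ (Fin n)) (hg : IsBddKer g),
      (∀ x t, x < t → g x t = 0) ∧ (1 + hk.op r) * (1 + hg.op r) = 1 := by
  obtain ⟨C, hC⟩ := hk.2
  obtain ⟨g, hgm, hgb, hg⟩ := exists_resolvent_kernel hr hk.1 hC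
  have hg0 : ∀ x t, x < t → g x t = 0 := fun x t h => by
    rw [hg]; exact cutTriangle_of_lt h _
  have hgk : IsBddKer g := ⟨hgm, hgb⟩
  refine ⟨g, hgk, hg0, ?_⟩
  -- The resolvent equation read as `K G = -(G + K)`, which is `(1 + K)(1 + G) = 1`. Above the
  -- diagonal all kernels vanish.
  have key : hk.op r ∘L hgk.op r = (hgk.add hk).neg.op r := by
    refine hk.op_comp hgk _ fun x hx t ht => ?_
    rcases lt_or_ge x t with h | h
    · rw [hg0 x t h, hk0 x t h]
      simp only [add_zero, neg_zero]
      refine integral_eq_zero_of_ae (Eventually.of_forall fun s => ?_)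
      rcases lt_or_ge x s with h' | h'
      · simp [hk0 x s h']
      · simp [hg0 s t (h'.trans_lt h)]
    · have e := congrFun (congrFun hg x) t
      rw [sourceKer, cutTriangle_of_le ht.1.le h hx.2.le] at e
      have e2 : ∀ s, (if t ≤ s ∧ s ≤ x then -k x s * g s t else 0) = -(k x s * g s t) := by
        intro s
        split_ifs with hs
        · exact neg_mul (k x s) (g s t)
        · rw [not_and_or, not_le, not_le] at hs
          rcases hs with hs | hs
          · simp [hg0 s t hs]
          · simp [hk0 x s hs]
      simp only [e2] at e
      rw [integral_neg] at e
      rw [e]; abel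
  rw [(hgk.add hk).op_neg, hgk.op_add hk] at key
  rw [mul_add, mul_one, add_mul, one_mul, ContinuousLinearMap.mul_def, key]
  abel

/-- The right inverse is again the identity plus a Volterra operator, so it has a right inverse too;
the two one-sided inverses then force two-sided invertibility. -/
theorem IsBddKer.isUnit_one_add_op (hr : 0 < r) (hk : IsBddKer k)
    (hk0 : ∀ x t, x < t → k x t = 0) : IsUnit (1 + hk.op r) := by
  obtain ⟨g, hg, hg0, h1⟩ := hk.exists_right_inverse hr hk0
  obtain ⟨_, _, _, h2⟩ := hg.exists_right_inverse hr hg0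
  have h3 := left_inv_eq_right_inv h1 h2
  rw [← h3] at h2
  exact ⟨⟨_, _, h1, h2⟩, rfl⟩

/-- Multiplication by a bounded measurable operator-valued function. -/
theorem exists_mulOp {u : ℝ → EuclideanSpace ℂ (Fin n) →L[ℂ] EuclideanSpace ℂ (Fin n)}
    (hu : AEStronglyMeasurable u (volume.restrict (Ioo 0 r))) {C : ℝ}
    (hC : ∀ x ∈ Ioo 0 r, ‖u x‖ ≤ C) :
    ∃ U : L2 n r →L[ℂ] L2 n r, ∀ f, U f =ᵐ[volume.restrict (Ioo 0 r)] fun x => u x (f x) := by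
  have hae : ∀ f : L2 n r, ∀ᵐ x ∂volume.restrict (Ioo 0 r), ‖u x (f x)‖ ≤ C * ‖f x‖ := fun f => by
    filter_upwards [ae_restrict_mem measurableSet_Ioo] with x hx
    exact (u x).le_of_opNorm_le (hC x hx) (f x)
  have hmem : ∀ f : L2 n r, MemLp (fun x => u x (f x)) 2 (volume.restrict (Ioo 0 r)) := fun f =>
    MemLp.of_le_mul (Lp.memLp f) (isBoundedBilinearMap_apply.continuous.comp_aestronglyMeasurable
      (hu.prodMk (Lp.aestronglyMeasurable f))) (hae f)
  refine ⟨LinearMap.mkContinuousOfExistsBound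
    { toFun := fun f => (hmem f).toLp
      map_add' := fun f g => by
        rw [← MemLp.toLp_add]
        refine MemLp.toLp_congr _ _ ?_
        filter_upwards [Lp.coeFn_add f g] with t ht
        rw [ht, Pi.add_apply, map_add, Pi.add_apply]
      map_smul' := fun c f => by
        rw [RingHom.id_apply, ← MemLp.toLp_const_smul]
        refine MemLp.toLp_congr _ _ ?_
        filter_upwards [Lp.coeFn_smul c f] with t ht
        rw [ht, Pi.smul_apply, map_smul, Pi.smul_apply] }
    ⟨C, fun f => Lp.norm_le_mul_norm_of_ae_le_mul ?_⟩, fun f => (hmem f).coeFn_toLp⟩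
  filter_upwards [hae f, (hmem f).coeFn_toLp] with x h1 h2
  simp only [LinearMap.coe_mk, AddHom.coe_mk]
  rwa [h2]

end IntegralOperators


/-! ### Similarity of `-J(1 + R)J` and `-J²` -/

section Similarity

open Filter Topology

variable {n : ℕ} {r : ℝ}
  {k l : ℝ → ℝ → EuclideanSpace ℂ (Fin n) →L[ℂ] EuclideanSpace ℂ (Fin n)}

theorem IsBddKer.cutTriangle (hk : IsBddKer k) (r : ℝ) : IsBddKer (cutTriangle r k) := by
  obtain ⟨hk, C, hC⟩ := hk
  exact ⟨stronglyMeasurable_cutTriangle hk, C, norm_cutTriangle_le hC⟩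

theorem isBddKer_one :
    IsBddKer fun _ _ => (1 : EuclideanSpace ℂ (Fin n) →L[ℂ] EuclideanSpace ℂ (Fin n)) :=
  ⟨stronglyMeasurable_const, 1, fun _ _ => ContinuousLinearMap.norm_id_le⟩

theorem setIntegral_ker_mul {x t : ℝ} (hx : x ∈ Ioo 0 r) (ht : t ∈ Ioo 0 r)
    (hk : ∀ s, x < s → k x s = 0) (hl : ∀ s, s < t → l s t = 0) :
    ∫ s in Ioo 0 r, k x s * l s t = if t ≤ x then ∫ s in t..x, k x s * l s t else 0 := by
  have e : ∀ s, k x s * l s t = if t ≤ s ∧ s ≤ x then k x s * l s t else 0 := by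
    intro s
    split_ifs with h
    · rfl
    · rw [not_and_or, not_le, not_le] at h
      rcases h with h | h
      · rw [hl s h, mul_zero]
      · rw [hk s h, zero_mul]
  split_ifs with h
  · rw [← setIntegral_ite_le_le ht.1.le h hx.2.le]
    exact integral_congr_ae (Eventually.of_forall e)
  · refine integral_eq_zero_of_ae (Eventually.of_forall fun s => ?_)
    simp only
    rw [e, if_neg fun h' => h (h'.1.trans h'.2)]
    rfl

theorem setIntegral_one_mul {x t : ℝ} (hx : x ∈ Ioo 0 r) (ht : t ∈ Ioo 0 r)
    (hl : ∀ s, s < t → l s t = 0) :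
    ∫ s in Ioo 0 r, cutTriangle r (fun _ _ => 1) x s * l s t =
      if t ≤ x then ∫ s in t..x, l s t else 0 := by
  rw [setIntegral_ker_mul hx ht (fun s h => cutTriangle_of_lt h _) hl]
  split_ifs with h
  · refine intervalIntegral.integral_congr fun s hs => ?_
    rw [uIcc_of_le h] at hs
    rw [cutTriangle_of_le (ht.1.le.trans hs.1) hs.2 hx.2.le, one_mul]
  · rfl

theorem setIntegral_mul_one {x t : ℝ} (hx : x ∈ Ioo 0 r) (ht : t ∈ Ioo 0 r)
    (hk : ∀ s, x < s → k x s = 0) :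
    ∫ s in Ioo 0 r, k x s * cutTriangle r (fun _ _ => 1) s t =
      if t ≤ x then ∫ s in t..x, k x s else 0 := by
  rw [setIntegral_ker_mul hx ht hk (fun s h => cutTriangle_of_lt h _)]
  split_ifs with h
  · refine intervalIntegral.integral_congr fun s hs => ?_
    rw [uIcc_of_le h] at hs
    rw [cutTriangle_of_le ht.1.le hs.1 (hs.2.trans hx.2.le), mul_one]
  · rfl

/-- The operator of integration. -/
def intJ (n : ℕ) (r : ℝ) : L2 n r →L[ℂ] L2 n r := (isBddKer_one.cutTriangle r).op r

theorem opA_eq : opA n r = -(intJ n r * intJ n r) := by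
  ext1 f
  have hJ : IsBddKer (n := n) (cutTriangle r fun _ _ => 1) := isBddKer_one.cutTriangle r
  refine Lp.ext ?_
  filter_upwards [coeFn_opA f, hJ.coeFn_op_comp hJ f, Lp.coeFn_neg ((intJ n r * intJ n r) f),
    ae_restrict_mem measurableSet_Ioo] with x h1 h2 h3 hx
  rw [h1, neg_apply, h3, Pi.neg_apply, intJ, ContinuousLinearMap.mul_def, h2, Afun,
    ← setIntegral_ite_le ⟨hx.1.le, hx.2.le⟩, ← integral_neg]
  refine setIntegral_congr_fun measurableSet_Ioo fun t ht => ?_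
  rw [setIntegral_one_mul hx ht (fun s h => cutTriangle_of_lt h _)]
  split_ifs with h
  · have : ∫ s in t..x, cutTriangle (𝔸 := EuclideanSpace ℂ (Fin n) →L[ℂ] EuclideanSpace ℂ (Fin n))
        r (fun _ _ => 1) s t = ∫ _ in t..x, 1 :=
      intervalIntegral.integral_congr fun s hs => by
        rw [uIcc_of_le h] at hs
        exact cutTriangle_of_le ht.1.le hs.1 (hs.2.trans hx.2.le) _
    rw [this, intervalIntegral.integral_const, smul_apply, ← neg_smul, neg_sub]
    rfl
  · simp

/-- A Volterra operator with kernel `-h`, where `h` is obtained from `J + J (J Q) J`, is similar to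
`-J²` by means of the identity plus a Volterra operator with bounded kernel. -/
theorem exists_similarity (hr : 0 < r)
    {q ρ σ κ : ℝ → ℝ → EuclideanSpace ℂ (Fin n) →L[ℂ] EuclideanSpace ℂ (Fin n)}
    (hq : StronglyMeasurable (Function.uncurry q)) {μ : ℝ → ℝ}
    (hμ : MemLp μ 2 (volume.restrict (Ioo 0 r))) (hqμ : ∀ x t, ‖q x t‖ ≤ μ x)
    (hρ : IsBddKer ρ) (hσ : IsBddKer σ) (hκ : IsBddKer κ)
    (hqρ : ∀ x t, 0 ≤ t → t ≤ x → x ≤ r → ∫ s in t..x, q s t = ρ x t)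
    (hρσ : ∀ x t, 0 ≤ t → t ≤ x → x ≤ r → ∫ s in t..x, ρ x s = -1 - σ x t)
    (hσκ : ∀ x t, 0 ≤ t → t ≤ x → x ≤ r → ∫ s in t..x, σ s t = κ x t) :
    ∃ (w : ℝ → ℝ → EuclideanSpace ℂ (Fin n) →L[ℂ] EuclideanSpace ℂ (Fin n)) (hw : IsBddKer w),
      (∀ x t, x < t → w x t = 0) ∧
      (hκ.cutTriangle r).op r * (1 + hw.op r) = (1 + hw.op r) * opA n r := by
  obtain ⟨y, w, p, hy, hw, hp, hy0, hw0, hp0, h⟩ := exists_intertwining_kernels hr hq hμ hqμ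
  have hy' : IsBddKer y := hy
  have hw' : IsBddKer w := hw
  have hp' : IsBddKer p := hp
  refine ⟨w, hw, hw0, ?_⟩
  have hJ : IsBddKer (n := n) (cutTriangle r fun _ _ => 1) := isBddKer_one.cutTriangle r
  have hR := hρ.cutTriangle r
  have hS := hσ.cutTriangle r
  set J := intJ n r
  set Y := hy'.op r
  set W := hw'.op r
  set P := hp'.op r
  set R := hR.op r
  set S := hS.op r
  -- The relations `h1` to `h5` are identities between kernels. `Q` is never formed as an operator,
  -- since `q` need not be bounded; its bounded primitive `R` takes its place.
  have h1 : W * J = J * (Y + P) := by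
    rw [← hy'.op_add hp']
    refine hw'.op_comp_eq hJ hJ (hy'.add hp') fun x hx t ht => ?_
    rw [setIntegral_mul_one hx ht fun s hs => hw0 x s hs, setIntegral_one_mul
      (l := fun x t => y x t + p x t) hx ht fun s hs => by simp [hy0 s t hs, hp0 s t hs]]
    split_ifs with htx
    · exact (h x t ht.1.le htx hx.2.le).1
    · rfl
  have h2 : Y * J = J * W := by
    refine hy'.op_comp_eq hJ hJ hw' fun x hx t ht => ?_
    rw [setIntegral_mul_one hx ht fun s hs => hy0 x s hs, setIntegral_one_mul hx ht
      fun s hs => hw0 s t hs]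
    split_ifs with htx
    · exact (h x t ht.1.le htx hx.2.le).2.1
    · rfl
  have h3 : R * Y = P - R := by
    have e : (hp'.add hR.neg).op r = P - R := by
      rw [hp'.op_add hR.neg, hR.op_neg, sub_eq_add_neg]
    rw [← e]
    refine hR.op_comp hy' _ fun x hx t ht => ?_
    rw [setIntegral_ker_mul hx ht (fun s hs => cutTriangle_of_lt hs _) fun s hs => hy0 s t hs]
    split_ifs with htx
    · rw [(h x t ht.1.le htx hx.2.le).2.2, cutTriangle_of_le ht.1.le htx hx.2.le,
        hqρ x t ht.1.le htx hx.2.le, add_comm (ρ x t), add_neg_cancel_right]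
      refine intervalIntegral.integral_congr fun s hs => ?_
      rw [uIcc_of_le htx] at hs
      have hs0 := ht.1.le.trans hs.1
      rw [cutTriangle_of_le hs0 hs.2 hx.2.le, hqρ x s hs0 hs.2 hx.2.le]
    · rw [hp0 x t (not_le.1 htx), cutTriangle_of_lt (not_le.1 htx), neg_zero, add_zero]
  have h4 : R * J = -J - S := by
    have e : (hJ.neg.add hS.neg).op r = -J - S := by
      rw [hJ.neg.op_add hS.neg, hS.op_neg, hJ.op_neg, sub_eq_add_neg]
      rfl
    rw [← e]
    refine hR.op_comp hJ _ fun x hx t ht => ?_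
    rw [setIntegral_mul_one hx ht fun s hs => cutTriangle_of_lt hs _]
    split_ifs with htx
    · rw [cutTriangle_of_le ht.1.le htx hx.2.le, cutTriangle_of_le ht.1.le htx hx.2.le,
        ← sub_eq_add_neg, ← hρσ x t ht.1.le htx hx.2.le]
      refine intervalIntegral.integral_congr fun s hs => ?_
      rw [uIcc_of_le htx] at hs
      exact cutTriangle_of_le (ht.1.le.trans hs.1) hs.2 hx.2.le _
    · rw [cutTriangle_of_lt (not_le.1 htx), cutTriangle_of_lt (not_le.1 htx), neg_zero, add_zero]
  have h5 : J * S = (hκ.cutTriangle r).op r := by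
    refine hJ.op_comp hS _ fun x hx t ht => ?_
    rw [setIntegral_one_mul hx ht fun s hs => cutTriangle_of_lt hs _]
    split_ifs with htx
    · rw [cutTriangle_of_le ht.1.le htx hx.2.le, ← hσκ x t ht.1.le htx hx.2.le]
      refine intervalIntegral.integral_congr fun s hs => ?_
      rw [uIcc_of_le htx] at hs
      exact cutTriangle_of_le ht.1.le hs.1 (hs.2.trans hx.2.le) _
    · rw [cutTriangle_of_lt (not_le.1 htx)]
  change _ * (1 + W) = (1 + W) * _
  have hS' : S = -J - R * J := by rw [h4]; abel
  have hP : P = R * Y + R := by rw [h3]; abel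
  -- The intertwining is done one factor `J` at a time: `a2` moves `1 + W` on the right past `J`
  -- into `1 + Y`, and `a1` turns `J (1 + R)(1 + Y)` into `(1 + W) J`.
  have a1 : (1 + W) * J = J * ((1 + R) * (1 + Y)) := by
    rw [add_mul, h1, hP]; noncomm_ring
  have a2 : (1 + Y) * J = J * (1 + W) := by
    rw [add_mul, h2]; noncomm_ring
  calc _ = J * S * (1 + W) := by rw [h5]
    _ = -(J * ((1 + R) * (J * (1 + W)))) := by rw [hS']; noncomm_ring
    _ = -((1 + W) * J * J) := by rw [← a2, a1]; noncomm_ring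
    _ = (1 + W) * opA n r := by rw [opA_eq]; noncomm_ring

end Similarity


/-! ### Calculus for primitives of square integrable functions -/

section L2Derivatives

open Filter Topology

variable {r : ℝ} {E F H : Type*} [NormedAddCommGroup E] [NormedSpace ℝ E]
  [NormedAddCommGroup F] [NormedSpace ℝ F] [NormedAddCommGroup H] [NormedSpace ℝ H]

/-- `G` is a primitive on `[0,r]` of the square integrable function `G'`. -/
def HasL2Deriv (r : ℝ) (G G' : ℝ → E) : Prop :=
  MemLp G' 2 (volume.restrict (Ioo 0 r)) ∧ ∀ x ∈ Icc 0 r, G x = G 0 + ∫ t in (0 : ℝ)..x, G' t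

theorem HasL2Deriv.intervalIntegrable {G G' : ℝ → E} (h : HasL2Deriv r G G') {a b : ℝ}
    (ha : a ∈ Icc 0 r) (hb : b ∈ Icc 0 r) : IntervalIntegrable G' volume a b := by
  have h1 : IntegrableOn G' (Icc 0 r) := by
    rw [integrableOn_Icc_iff_integrableOn_Ioo]; exact h.1.integrable (by norm_num)
  exact (h1.mono_set (uIcc_subset_Icc ha hb)).intervalIntegrable

theorem HasL2Deriv.integral_eq_sub {G G' : ℝ → E} (h : HasL2Deriv r G G') {a b : ℝ}
    (ha : a ∈ Icc 0 r) (hb : b ∈ Icc 0 r) : ∫ t in a..b, G' t = G b - G a := by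
  have h0 : (0 : ℝ) ∈ Icc 0 r := ⟨le_rfl, ha.1.trans ha.2⟩
  rw [h.2 a ha, h.2 b hb, add_sub_add_left_eq_sub, intervalIntegral.integral_interval_sub_left
    (h.intervalIntegrable h0 hb) (h.intervalIntegrable h0 ha)]

theorem HasL2Deriv.continuousOn {G G' : ℝ → E} (h : HasL2Deriv r G G') :
    ContinuousOn G (Icc 0 r) := by
  rcases lt_or_ge r 0 with hr | hr
  · simp [Icc_eq_empty_of_lt hr]
  · have := intervalIntegral.continuousOn_primitive_interval (a := 0) (b := r) (f := G')
      (μ := volume) (by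
        rw [uIcc_of_le hr, integrableOn_Icc_iff_integrableOn_Ioo]
        exact h.1.integrable (by norm_num))
    rw [uIcc_of_le hr] at this
    exact (continuousOn_const.add this).congr h.2

omit [NormedSpace ℝ E] in
theorem memLp_of_continuousOn {G : ℝ → E} (hG : ContinuousOn G (Icc 0 r)) :
    MemLp G 2 (volume.restrict (Ioo 0 r)) := by
  obtain ⟨C, hC⟩ := isCompact_Icc.exists_bound_of_continuousOn hG
  refine MemLp.of_bound ((hG.mono Ioo_subset_Icc_self).aestronglyMeasurable measurableSet_Ioo) C ?_
  filter_upwards [ae_restrict_mem measurableSet_Ioo] with x hx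
  exact hC x (Ioo_subset_Icc_self hx)

theorem HasL2Deriv.congr_ae {G G' G'' : ℝ → E} (h : HasL2Deriv r G G')
    (he : G' =ᵐ[volume.restrict (Ioo 0 r)] G'') : HasL2Deriv r G G'' := by
  refine ⟨(memLp_congr_ae he).1 h.1, fun x hx => ?_⟩
  rw [h.2 x hx, intervalIntegral.integral_of_le hx.1, intervalIntegral.integral_of_le hx.1,
    integral_Ioc_eq_integral_Ioo, integral_Ioc_eq_integral_Ioo]
  congr 1
  exact integral_congr_ae (ae_restrict_of_ae_restrict_of_subset (Ioo_subset_Ioo_right hx.2) he)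

theorem HasL2Deriv.congr_left {G K G' : ℝ → E} (h : HasL2Deriv r G G')
    (he : ∀ x ∈ Icc 0 r, K x = G x) : HasL2Deriv r K G' := by
  refine ⟨h.1, fun x hx => ?_⟩
  rw [he x hx, he 0 ⟨le_rfl, hx.1.trans hx.2⟩, h.2 x hx]

theorem HasL2Deriv.eq_zero_of_deriv_eq_zero {G G' : ℝ → E} (h : HasL2Deriv r G G')
    (h0 : ∀ x ∈ Icc 0 r, G' x = 0) {x : ℝ} (hx : x ∈ Icc 0 r) : G x = G 0 := by
  rw [h.2 x hx, intervalIntegral.integral_congr (g := fun _ => 0)]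
  · simp
  · intro s hs
    rw [uIcc_of_le hx.1] at hs
    exact h0 s ⟨hs.1, hs.2.trans hx.2⟩

theorem HasL2Deriv.add {G G' K K' : ℝ → E} (hG : HasL2Deriv r G G') (hK : HasL2Deriv r K K') :
    HasL2Deriv r (fun x => G x + K x) fun x => G' x + K' x := by
  refine ⟨hG.1.add hK.1, fun x hx => ?_⟩
  have h0 : (0 : ℝ) ∈ Icc 0 r := ⟨le_rfl, hx.1.trans hx.2⟩
  rw [intervalIntegral.integral_add (hG.intervalIntegrable h0 hx) (hK.intervalIntegrable h0 hx),
    hG.integral_eq_sub h0 hx, hK.integral_eq_sub h0 hx, ← add_sub_add_comm]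
  exact (add_sub_cancel (G 0 + K 0) (G x + K x)).symm

theorem HasL2Deriv.clm [CompleteSpace E] [CompleteSpace F] {G G' : ℝ → E}
    (hG : HasL2Deriv r G G') (L : E →L[ℝ] F) :
    HasL2Deriv r (fun x => L (G x)) fun x => L (G' x) := by
  refine ⟨L.comp_memLp' hG.1, fun x hx => ?_⟩
  have h0 : (0 : ℝ) ∈ Icc 0 r := ⟨le_rfl, hx.1.trans hx.2⟩
  rw [L.intervalIntegral_comp_comm (hG.intervalIntegrable h0 hx), ← map_add, ← hG.2 x hx]

theorem memLp_bilin_left (L : E →L[ℝ] F →L[ℝ] H) {G' : ℝ → E} {K : ℝ → F}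
    (hG : MemLp G' 2 (volume.restrict (Ioo 0 r))) (hK : ContinuousOn K (Icc 0 r)) :
    MemLp (fun x => L (G' x) (K x)) 2 (volume.restrict (Ioo 0 r)) := by
  obtain ⟨C, hC⟩ := isCompact_Icc.exists_bound_of_continuousOn hK
  refine MemLp.of_le_mul (c := ‖L‖ * C) hG (L.continuous₂.comp_aestronglyMeasurable
    (hG.aestronglyMeasurable.prodMk
      ((hK.mono Ioo_subset_Icc_self).aestronglyMeasurable measurableSet_Ioo))) ?_
  filter_upwards [ae_restrict_mem measurableSet_Ioo] with x hx
  calc _ ≤ ‖L‖ * ‖G' x‖ * ‖K x‖ := L.le_opNorm₂ _ _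
    _ ≤ ‖L‖ * ‖G' x‖ * C := by gcongr; exact hC x (Ioo_subset_Icc_self hx)
    _ = _ := by ring

/-- The product rule without pointwise derivatives: Fubini for `L (G' s) (K' t)` over a triangle is
integration by parts. -/
theorem HasL2Deriv.bilin [CompleteSpace E] [CompleteSpace F] [CompleteSpace H]
    (L : E →L[ℝ] F →L[ℝ] H) {G G' : ℝ → E} {K K' : ℝ → F}
    (hG : HasL2Deriv r G G') (hK : HasL2Deriv r K K') :
    HasL2Deriv r (fun x => L (G x) (K x)) fun x => L (G' x) (K x) + L (G x) (K' x) := by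
  have m1 := memLp_bilin_left L hG.1 hK.continuousOn
  have m2 := memLp_bilin_left L.flip hK.1 hG.continuousOn
  refine ⟨m1.add m2, fun x hx => ?_⟩
  have h0 : (0 : ℝ) ∈ Icc 0 r := ⟨le_rfl, hx.1.trans hx.2⟩
  have iG := fun {a b : ℝ} => hG.intervalIntegrable (a := a) (b := b)
  have iK := fun {a b : ℝ} => hK.intervalIntegrable (a := a) (b := b)
  have hio : ∀ {g : ℝ → H}, MemLp g 2 (volume.restrict (Ioo 0 r)) →
      IntervalIntegrable g volume 0 x := fun {g} hg => by
    rw [intervalIntegrable_iff_integrableOn_Ioo_of_le hx.1]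
    have : IntegrableOn g (Ioo 0 r) := hg.integrable (by norm_num)
    exact this.mono_set (Ioo_subset_Ioo_right hx.2)
  have hF : Integrable (Function.uncurry fun s t => L (G' s) (K' t))
      ((volume.restrict (Ioc 0 x)).prod (volume.restrict (Ioc 0 x))) := by
    have jG : Integrable G' (volume.restrict (Ioc 0 x)) :=
      (intervalIntegrable_iff_integrableOn_Ioc_of_le hx.1).1 (iG h0 hx)
    have jK : Integrable K' (volume.restrict (Ioc 0 x)) :=
      (intervalIntegrable_iff_integrableOn_Ioc_of_le hx.1).1 (iK h0 hx)
    refine Integrable.mono' ((jG.norm.mul_prod jK.norm).const_mul ‖L‖) ?_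
      (Eventually.of_forall fun p => ?_)
    · exact L.continuous₂.comp_aestronglyMeasurable
        (jG.aestronglyMeasurable.comp_fst.prodMk jK.aestronglyMeasurable.comp_snd)
    · exact (L.le_opNorm₂ _ _).trans (le_of_eq (by ring))
  have mem : ∀ s ∈ uIcc 0 x, s ∈ Icc 0 r := fun s hs => by
    rw [uIcc_of_le hx.1] at hs; exact ⟨hs.1, hs.2.trans hx.2⟩
  have e1 : ∫ s in (0 : ℝ)..x, L (G' s) (K s - K 0) =
      ∫ t in (0 : ℝ)..x, L (G x - G t) (K' t) := by
    have := integral_triangle_swap hx.1 hF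
    refine Eq.trans (intervalIntegral.integral_congr fun s hs => ?_)
      (this.trans (intervalIntegral.integral_congr fun t ht => ?_))
    · rw [← hK.integral_eq_sub h0 (mem s hs),
        (L (G' s)).intervalIntegral_comp_comm (iK h0 (mem s hs))]
    · rw [← hG.integral_eq_sub (mem t ht) hx, ← L.flip_apply,
        ← (L.flip (K' t)).intervalIntegral_comp_comm (iG (mem t ht) hx)]
      rfl
  have c1 : IntervalIntegrable (fun s => L (G' s) (K 0)) volume 0 x :=
    hio (memLp_bilin_left L hG.1 (K := fun _ => K 0) continuousOn_const)
  have c2 : IntervalIntegrable (fun s => L (G x) (K' s)) volume 0 x :=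
    hio (memLp_bilin_left L.flip hK.1 (K := fun _ => G x) continuousOn_const)
  have m2' : IntervalIntegrable (fun s => L (G s) (K' s)) volume 0 x := hio m2
  simp only [map_sub, sub_apply] at e1
  rw [intervalIntegral.integral_sub (hio m1) c1, intervalIntegral.integral_sub c2 m2',
    (L (G x)).intervalIntegral_comp_comm (iK h0 hx), hK.integral_eq_sub h0 hx] at e1
  have e2 : ∫ s in (0 : ℝ)..x, L (G' s) (K 0) = L (G x - G 0) (K 0) := by
    rw [← hG.integral_eq_sub h0 hx, ← L.flip_apply,
      ← (L.flip (K 0)).intervalIntegral_comp_comm (iG h0 hx)]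
    rfl
  rw [intervalIntegral.integral_add (hio m1) m2']
  rw [e2, sub_eq_iff_eq_add] at e1
  rw [e1]
  simp only [map_sub, sub_apply]
  abel

-- Kernels are required to be measurable and bounded on the whole plane, so functions on `[0,r]` are
-- continued by their end values.
omit [NormedSpace ℝ E] in
theorem exists_continuous_extension (hr : 0 ≤ r) {G : ℝ → E} (hG : ContinuousOn G (Icc 0 r)) :
    ∃ K : ℝ → E, Continuous K ∧ (∃ C, ∀ x, ‖K x‖ ≤ C) ∧ ∀ x ∈ Icc 0 r, K x = G x := by
  obtain ⟨C, hC⟩ := isCompact_Icc.exists_bound_of_continuousOn hG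
  refine ⟨IccExtend hr ((Icc 0 r).domRestrict G), hG.domRestrict.Icc_extend',
    ⟨C, fun x => hC _ (projIcc 0 r hr x).2⟩, fun x hx => ?_⟩
  rw [IccExtend_of_mem hr _ hx, domRestrict_apply]

theorem HasL2Deriv.hasDerivWithinAt [CompleteSpace E] {G G' : ℝ → E} (hG : HasL2Deriv r G G')
    (hG' : ContinuousOn G' (Icc 0 r)) {x : ℝ} (hx : x ∈ Icc 0 r) :
    HasDerivWithinAt G (G' x) (Icc 0 r) x := by
  obtain ⟨K, hK, -, hKG⟩ := exists_continuous_extension (hx.1.trans hx.2) hG'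
  have h := ((hK.integral_hasStrictDerivAt 0 x).hasDerivAt.const_add (G 0)).hasDerivWithinAt
    (s := Icc 0 r)
  rw [hKG x hx] at h
  have e : ∀ y ∈ Icc 0 r, G y = G 0 + ∫ t in (0 : ℝ)..y, K t := fun y hy => by
    rw [hG.2 y hy]
    congr 1
    refine intervalIntegral.integral_congr fun s hs => ?_
    rw [uIcc_of_le hy.1] at hs
    exact (hKG s ⟨hs.1, hs.2.trans hy.2⟩).symm
  exact h.congr e (e x hx)

theorem hasL2Deriv_of_hasDerivWithinAt [CompleteSpace E] {G G' : ℝ → E}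
    (hG : ∀ x ∈ Icc 0 r, HasDerivWithinAt G (G' x) (Icc 0 r) x)
    (hG' : ContinuousOn G' (Icc 0 r)) : HasL2Deriv r G G' := by
  refine ⟨memLp_of_continuousOn hG', fun x hx => ?_⟩
  have hsub : Icc 0 x ⊆ Icc 0 r := Icc_subset_Icc_right hx.2
  rw [intervalIntegral.integral_eq_sub_of_hasDeriv_right_of_le hx.1
    (fun y hy => (hG y (hsub hy)).continuousWithinAt.mono hsub) (fun y hy => ?_)
    ((hG'.mono hsub).intervalIntegrable_of_Icc hx.1)]
  · abel
  · have : Icc 0 r ∈ 𝓝 y := Icc_mem_nhds hy.1 (hy.2.trans_le hx.2)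
    exact ((hG y (hsub (Ioo_subset_Icc_self hy))).hasDerivAt this).hasDerivWithinAt

/-- The linear differential equation `u' = M u`, `u(0) = 1` has a solution on `[0,r]`. -/
theorem exists_fundamental_solution {𝔸 : Type*} [NormedRing 𝔸] [NormedAlgebra ℝ 𝔸]
    [CompleteSpace 𝔸] (hr : 0 < r) {M : ℝ → 𝔸} (hM : ContinuousOn M (Icc 0 r)) :
    ∃ u : ℝ → 𝔸, u 0 = 1 ∧ HasL2Deriv r u fun x => M x * u x := by
  obtain ⟨N, hN, ⟨C, hC⟩, hNM⟩ := exists_continuous_extension hr.le hM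
  -- For this kernel the resolvent equation at `t = 0` is `g(x,0) = N(x)(1 + ∫₀ˣ g(s,0) ds)`, so
  -- `g(·,0)` is the derivative of the wanted solution.
  obtain ⟨g, hg, ⟨D, hD⟩, hgN⟩ := exists_resolvent_kernel hr (w := fun x _ => -N x) (C := C)
    (hN.comp continuous_fst).neg.stronglyMeasurable (fun x _ => by simpa using hC x)
  have hgm : StronglyMeasurable fun x => g x 0 := hg.comp_measurable measurable_prodMk_right
  have hgi := intervalIntegrable_of_bounded hgm fun x => hD x 0
  have hgL : MemLp (fun x => g x 0) 2 (volume.restrict (Ioo 0 r)) :=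
    MemLp.of_bound hgm.aestronglyMeasurable D (Eventually.of_forall fun x => hD x 0)
  have key : ∀ x ∈ Icc 0 r, g x 0 = M x * (1 + ∫ s in (0 : ℝ)..x, g s 0) := by
    intro x hx
    have e := congrFun (congrFun hgN x) 0
    rw [sourceKer, cutTriangle_of_le le_rfl hx.1 hx.2] at e
    rw [e, setIntegral_ite_le_le le_rfl hx.1 hx.2, mul_add, mul_one, ← hNM x hx]
    simp only [neg_neg]
    congr 1
    exact ((ContinuousLinearMap.mul ℝ 𝔸) (N x)).intervalIntegral_comp_comm (hgi 0 x)
  have h : HasL2Deriv r (fun x => 1 + ∫ s in (0 : ℝ)..x, g s 0) fun x => g x 0 :=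
    ⟨hgL, fun x _ => by simp⟩
  refine ⟨_, by simp, h.congr_ae ?_⟩
  filter_upwards [ae_restrict_mem measurableSet_Ioo] with x hx
  exact key x (Ioo_subset_Icc_self hx)

end L2Derivatives


/-! ### Matrix functions and the normalizing frame -/

section MatrixFunctions

open Filter Topology

variable {r : ℝ} {a b c : Type*} [Fintype a] [Fintype b] [Fintype c]
  [DecidableEq a] [DecidableEq b] [DecidableEq c]

/-- Matrix multiplication as a continuous real bilinear map. -/
def matMul : Matrix a b ℂ →L[ℝ] Matrix b c ℂ →L[ℝ] Matrix a c ℂ :=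
  (LinearMap.mk₂ ℝ (fun A B => A * B) Matrix.add_mul (fun t A B => Matrix.smul_mul t A B)
    Matrix.mul_add (fun t A B => Matrix.mul_smul A t B)).mkContinuous₂ 1
    fun A B => by simpa using Matrix.l2_opNorm_mul A B

/-- Conjugate transposition as a continuous real linear map. -/
def matStar : Matrix a b ℂ →L[ℝ] Matrix b a ℂ :=
  LinearMap.mkContinuous
    { toFun := fun A => Aᴴ
      map_add' := Matrix.conjTranspose_add
      map_smul' := fun t A => by simp } 1
    fun A => by simpa using (Matrix.l2_opNorm_conjTranspose A).le

/-- A matrix entry as a continuous real linear map. -/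
def matEntry (i : a) (j : b) : Matrix a b ℂ →L[ℝ] ℂ :=
  ((Matrix.entryLinearMap ℂ ℂ i j).toContinuousLinearMap).restrictScalars ℝ

omit [DecidableEq a] in
theorem HasL2Deriv.mul {G G' : ℝ → Matrix a b ℂ} {K K' : ℝ → Matrix b c ℂ}
    (hG : HasL2Deriv r G G') (hK : HasL2Deriv r K K') :
    HasL2Deriv r (fun x => G x * K x) fun x => G' x * K x + G x * K' x :=
  hG.bilin matMul hK

omit [DecidableEq a] in
theorem HasL2Deriv.mul_const {G G' : ℝ → Matrix a b ℂ}
    (hG : HasL2Deriv r G G') (C : Matrix b c ℂ) :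
    HasL2Deriv r (fun x => G x * C) fun x => G' x * C :=
  hG.clm ((matMul (a := a) (b := b) (c := c)).flip C)

theorem HasL2Deriv.conjTranspose {G G' : ℝ → Matrix a b ℂ} (hG : HasL2Deriv r G G') :
    HasL2Deriv r (fun x => (G x)ᴴ) fun x => (G' x)ᴴ :=
  hG.clm matStar

omit [DecidableEq a] in
theorem HasL2Deriv.const_smul {G G' : ℝ → Matrix a b ℂ} (hG : HasL2Deriv r G G') (z : ℂ) :
    HasL2Deriv r (fun x => z • G x) fun x => z • G' x :=
  hG.clm (z • ContinuousLinearMap.id ℝ (Matrix a b ℂ))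

theorem matrix_eq_sum_entries (A : Matrix a b ℂ) :
    A = ∑ i, ∑ j, A i j • (Matrix.single i j (1 : ℂ)) := by
  conv_lhs => rw [Matrix.matrix_eq_sum_single A]
  simp [Matrix.smul_single]

theorem memLp_matrix {G : ℝ → Matrix a b ℂ}
    (h : ∀ i j, MemLp (fun x => G x i j) 2 (volume.restrict (Ioo 0 r))) :
    MemLp G 2 (volume.restrict (Ioo 0 r)) := by
  have e : G = fun x => ∑ i, ∑ j, G x i j • (Matrix.single i j (1 : ℂ)) := by
    funext x; exact matrix_eq_sum_entries (G x)
  rw [e]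
  refine memLp_finsetSum _ fun i _ => memLp_finsetSum _ fun j _ => ?_
  exact (ContinuousLinearMap.toSpanSingleton ℂ (Matrix.single i j (1 : ℂ))).comp_memLp' (h i j)

theorem hasL2Deriv_of_entries {G G' : ℝ → Matrix a b ℂ}
    (h : ∀ i j, HasL2Deriv r (fun x => G x i j) fun x => G' x i j) : HasL2Deriv r G G' := by
  have hm := memLp_matrix fun i j => (h i j).1
  refine ⟨hm, fun x hx => ?_⟩
  have hi : IntervalIntegrable G' volume 0 x := by
    have h1 : IntegrableOn G' (Ioo 0 r) := hm.integrable (by norm_num)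
    rw [intervalIntegrable_iff_integrableOn_Ioo_of_le hx.1]
    exact h1.mono_set (Ioo_subset_Ioo_right hx.2)
  ext i j
  rw [Matrix.add_apply]
  refine ((h i j).2 x hx).trans (congrArg _ ?_)
  exact (matEntry i j).intervalIntegral_comp_comm hi

omit [DecidableEq a] in
theorem HasL2Deriv.entry {G G' : ℝ → Matrix a b ℂ} (hG : HasL2Deriv r G G') (i : a) (j : b) :
    HasL2Deriv r (fun x => G x i j) fun x => G' x i j :=
  hG.clm (matEntry i j)

/-- The derivative is continuous, being a primitive of a square integrable function, so the
fundamental theorem of calculus applies to `G` itself. -/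
theorem MemU.exists_hasL2Deriv {G : ℝ → Matrix a b ℂ}
    (hG : MemU r G) :
    ∃ G'' : ℝ → Matrix a b ℂ, HasL2Deriv r G (matDeriv r G) ∧ HasL2Deriv r (matDeriv r G) G'' := by
  choose hd g hg hgi using hG
  have h2 : HasL2Deriv r (matDeriv r G) fun x => Matrix.of fun i j => g i j x :=
    hasL2Deriv_of_entries fun i j => ⟨hg i j, hgi i j⟩
  refine ⟨_, hasL2Deriv_of_entries fun i j => ?_, h2⟩
  exact hasL2Deriv_of_hasDerivWithinAt (fun x hx => (hd i j x hx).hasDerivWithinAt)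
    (h2.entry i j).continuousOn

omit [DecidableEq a] in
theorem memU_of_hasL2Deriv (hr : 0 < r) {G G' G'' : ℝ → Matrix a b ℂ} (hG : HasL2Deriv r G G')
    (hG' : HasL2Deriv r G' G'') : MemU r G := by
  intro i j
  have hd : ∀ x ∈ Icc 0 r, HasDerivWithinAt (fun y => G y i j) (G' x i j) (Icc 0 r) x :=
    fun x hx => (hG.entry i j).hasDerivWithinAt (hG'.entry i j).continuousOn hx
  refine ⟨fun x hx => (hd x hx).differentiableWithinAt, fun x => G'' x i j, (hG'.entry i j).1,
    fun x hx => ?_⟩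
  have h0 : (0 : ℝ) ∈ Icc 0 r := ⟨le_rfl, hr.le⟩
  have hu := uniqueDiffOn_Icc hr
  rw [(hd x hx).derivWithin (hu x hx), (hd 0 h0).derivWithin (hu 0 h0)]
  exact (hG'.entry i j).2 x hx

variable {m₁ m₂ : ℕ}

theorem sgnJ_conjTranspose : (sgnJ m₁ m₂)ᴴ = sgnJ m₁ m₂ := by
  simp [sgnJ, Matrix.fromBlocks_conjTranspose]

/-- Passing to a moving orthonormal frame `u` one may achieve `γ j γ* = 0` for the derivative `γ`
of `η = u* β`. -/
theorem exists_normalizing_frame (hr : 0 < r) {β : ℝ → Matrix (Fin m₂) (Fin m₁ ⊕ Fin m₂) ℂ}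
    (hβ : MemU r β) (hnorm : IsNormalized r β) :
    ∃ (u : ℝ → Matrix (Fin m₂) (Fin m₂) ℂ) (γ δ : ℝ → Matrix (Fin m₂) (Fin m₁ ⊕ Fin m₂) ℂ),
      MemU r u ∧ (∀ x ∈ Icc 0 r, u x ∈ Matrix.unitaryGroup (Fin m₂) ℂ) ∧
      HasL2Deriv r (fun x => (u x)ᴴ * β x) γ ∧ HasL2Deriv r γ δ ∧
      ∀ x ∈ Icc 0 r, ((u x)ᴴ * β x) * sgnJ m₁ m₂ * ((u x)ᴴ * β x)ᴴ = 0 ∧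
        γ x * sgnJ m₁ m₂ * ((u x)ᴴ * β x)ᴴ = Complex.I • 1 ∧
        γ x * sgnJ m₁ m₂ * (γ x)ᴴ = 0 := by
  obtain ⟨β₂, h1, h2⟩ := hβ.exists_hasL2Deriv
  set j := sgnJ m₁ m₂ with hj
  have hjs : jᴴ = j := sgnJ_conjTranspose
  set β₁ := matDeriv r β with hβ₁
  -- With `h = β' j β'*`, the equation `u' = (i/2) h u` gives `γ = u*(β' - (i/2) h β)`. In `γ j γ*`
  -- each of the two cross terms contributes `-h/2`, cancelling `h`. The coefficient has a square
  -- integrable derivative, hence so does `u'`.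
  have hH := ((h2.mul_const j).mul h2.conjTranspose).const_smul (Complex.I / 2)
  obtain ⟨u, hu0, hu1⟩ := exists_fundamental_solution hr hH.continuousOn
  have hu2 := hH.mul hu1
  have hγ := hu1.conjTranspose.mul h1
  have hδ := (hu2.conjTranspose.mul h1).add (hu1.conjTranspose.mul h2)
  have hHs : ∀ x, (β₁ x * j * (β₁ x)ᴴ)ᴴ = β₁ x * j * (β₁ x)ᴴ := fun x => by
    simp only [Matrix.conjTranspose_mul, Matrix.conjTranspose_conjTranspose, hjs, Matrix.mul_assoc]
  have hu' : ∀ x, ((Complex.I / 2) • (β₁ x * j * (β₁ x)ᴴ) * u x)ᴴ =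
      -(Complex.I / 2) • ((u x)ᴴ * (β₁ x * j * (β₁ x)ᴴ)) := fun x => by
    rw [Matrix.conjTranspose_mul, Matrix.conjTranspose_smul, hHs, Matrix.mul_smul]
    simp [neg_div]
  -- `(i/2) h` is skew-adjoint because `h` is self-adjoint, so `u* u` has zero derivative.
  have huni : ∀ x ∈ Icc 0 r, (u x)ᴴ * u x = 1 := by
    intro x hx
    have := (hu1.conjTranspose.mul hu1).eq_zero_of_deriv_eq_zero (fun y hy => ?_) hx
    · rw [this, hu0]; simp
    · rw [hu']
      simp only [Matrix.smul_mul, Matrix.mul_smul, Matrix.mul_assoc]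
      module
  refine ⟨u, _, _, memU_of_hasL2Deriv hr hu1 hu2, fun x hx => ?_, hγ, hδ, fun x hx => ?_⟩
  · rw [Matrix.mem_unitaryGroup_iff']
    exact huni x hx
  obtain ⟨n1, n2⟩ := hnorm x hx
  have n3 : β x * j * (β₁ x)ᴴ = -Complex.I • (1 : Matrix (Fin m₂) (Fin m₂) ℂ) := by
    have := congrArg Matrix.conjTranspose n2
    simpa [Matrix.conjTranspose_mul, hjs, Matrix.mul_assoc, ← hj, ← hβ₁] using this
  have n4 : β₁ x * j * (β x)ᴴ = Complex.I • (1 : Matrix (Fin m₂) (Fin m₂) ℂ) := n2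
  set h := β₁ x * j * (β₁ x)ᴴ with hh
  have hx3 := huni x hx
  have ex : ∀ (P Q : Matrix (Fin m₂) (Fin m₂) ℂ) (X Y : Matrix (Fin m₂) (Fin m₁ ⊕ Fin m₂) ℂ),
      (P * X) * j * (Q * Y)ᴴ = P * (X * j * Yᴴ) * Qᴴ := fun P Q X Y => by
    simp only [Matrix.conjTranspose_mul, Matrix.mul_assoc]
  refine ⟨?_, ?_, ?_⟩
  · rw [ex, n1]; simp
  · simp only [Matrix.add_mul]
    rw [ex, ex, n1, n4]
    simp [hx3]
  · simp only [Matrix.add_mul, Matrix.conjTranspose_add, Matrix.mul_add]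
    rw [ex, ex, ex, ex, n1, n3, n4, hu']
    simp only [← hh]
    have hhs : hᴴ = h := hHs x
    have hstar : star (-(Complex.I / 2)) = Complex.I / 2 := by simp [neg_div]
    simp only [Matrix.conjTranspose_smul, Matrix.conjTranspose_mul,
      Matrix.conjTranspose_conjTranspose, hhs, hstar, Matrix.mul_zero, Matrix.zero_mul,
      Matrix.mul_smul, Matrix.smul_mul, Matrix.mul_one, Matrix.mul_assoc]
    match_scalars
    ring_nf
    simp

end MatrixFunctions


/-! ### The kernel of `K` in the frame, and the change of frame -/

section Assembly

open Filter Topology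

variable {m₁ m₂ : ℕ} {r : ℝ}

/-- The operator `i G j F*`. -/
def sesq (G F : Matrix (Fin m₂) (Fin m₁ ⊕ Fin m₂) ℂ) :
    EuclideanSpace ℂ (Fin m₂) →L[ℂ] EuclideanSpace ℂ (Fin m₂) :=
  Matrix.toEuclideanCLM (𝕜 := ℂ) (n := Fin m₂) (Complex.I • (G * sgnJ m₁ m₂ * Fᴴ))

theorem norm_sesq_le (G F : Matrix (Fin m₂) (Fin m₁ ⊕ Fin m₂) ℂ) :
    ‖sesq G F‖ ≤ ‖sgnJ m₁ m₂‖ * ‖F‖ * ‖G‖ := by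
  rw [sesq, Matrix.l2_opNorm_toEuclideanCLM, norm_smul, Complex.norm_I, one_mul]
  calc _ ≤ ‖G * sgnJ m₁ m₂‖ * ‖Fᴴ‖ := Matrix.l2_opNorm_mul _ _
    _ ≤ ‖G‖ * ‖sgnJ m₁ m₂‖ * ‖F‖ := by
      rw [Matrix.l2_opNorm_conjTranspose]
      gcongr
      exact Matrix.l2_opNorm_mul _ _
    _ = _ := by ring

/-- `sesq` as a continuous real linear map of its first argument. -/
def sesqLeft (F : Matrix (Fin m₂) (Fin m₁ ⊕ Fin m₂) ℂ) : Matrix (Fin m₂) (Fin m₁ ⊕ Fin m₂) ℂ →L[ℝ]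
    EuclideanSpace ℂ (Fin m₂) →L[ℂ] EuclideanSpace ℂ (Fin m₂) :=
  LinearMap.mkContinuous
    { toFun := fun G => sesq G F
      map_add' := fun A B => by
        simp only [sesq, Matrix.add_mul, smul_add, map_add]
      map_smul' := fun t A => by
        simp only [sesq, Matrix.smul_mul, smul_comm _ t, RingHom.id_apply]
        exact (Matrix.toEuclideanCLM (𝕜 := ℂ) (n := Fin m₂)).toAlgEquiv.toLinearMap.map_smul_of_tower
          t _ } _ fun G => norm_sesq_le G F

/-- `sesq` as a continuous real linear map of its second argument. -/
def sesqRight (G : Matrix (Fin m₂) (Fin m₁ ⊕ Fin m₂) ℂ) :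
    Matrix (Fin m₂) (Fin m₁ ⊕ Fin m₂) ℂ →L[ℝ]
      EuclideanSpace ℂ (Fin m₂) →L[ℂ] EuclideanSpace ℂ (Fin m₂) :=
  LinearMap.mkContinuous
    { toFun := fun F => sesq G F
      map_add' := fun A B => by
        simp only [sesq, Matrix.conjTranspose_add, Matrix.mul_add, smul_add, map_add]
      map_smul' := fun t A => by
        simp only [sesq, Matrix.conjTranspose_smul, star_trivial, Matrix.mul_smul, smul_comm _ t,
          RingHom.id_apply]
        exact (Matrix.toEuclideanCLM (𝕜 := ℂ) (n := Fin m₂)).toAlgEquiv.toLinearMap.map_smul_of_tower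
          t _ } (‖sgnJ m₁ m₂‖ * ‖G‖)
    fun F => (norm_sesq_le G F).trans_eq (by ring)

theorem continuous_sesq : Continuous fun p : Matrix (Fin m₂) (Fin m₁ ⊕ Fin m₂) ℂ ×
    Matrix (Fin m₂) (Fin m₁ ⊕ Fin m₂) ℂ => sesq p.1 p.2 := by
  have h : Continuous (Matrix.toEuclideanCLM (𝕜 := ℂ) (n := Fin m₂)) :=
    AddMonoidHomClass.continuous_of_bound _ 1 fun A => by
      rw [Matrix.l2_opNorm_toEuclideanCLM, one_mul]
  exact h.comp (((continuous_fst.matrix_mul continuous_const).matrix_mul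
    continuous_snd.matrix_conjTranspose).const_smul Complex.I)

theorem isBddKer_sesq {G F : ℝ → Matrix (Fin m₂) (Fin m₁ ⊕ Fin m₂) ℂ} (hG : Continuous G)
    (hF : Continuous F) (hGb : ∃ C, ∀ x, ‖G x‖ ≤ C) (hFb : ∃ C, ∀ x, ‖F x‖ ≤ C) :
    IsBddKer fun x t => sesq (G x) (F t) := by
  obtain ⟨C, hC⟩ := hGb
  obtain ⟨D, hD⟩ := hFb
  have hD0 : 0 ≤ D := (norm_nonneg _).trans (hD 0)
  refine ⟨(continuous_sesq.comp ((hG.comp continuous_fst).prodMk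
    (hF.comp continuous_snd))).stronglyMeasurable, ‖sgnJ m₁ m₂‖ * D * C, fun x t => ?_⟩
  refine (norm_sesq_le _ _).trans ?_
  gcongr
  · exact hD t
  · exact hC x

theorem stronglyMeasurable_sesq {G F : ℝ → Matrix (Fin m₂) (Fin m₁ ⊕ Fin m₂) ℂ}
    (hG : StronglyMeasurable G) (hF : Continuous F) :
    StronglyMeasurable (Function.uncurry fun x t => sesq (G x) (F t)) := by
  have h1 : StronglyMeasurable fun p : ℝ × ℝ => G p.1 := hG.comp_measurable measurable_fst
  have h2 : StronglyMeasurable fun p : ℝ × ℝ => F p.2 :=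
    (hF.comp continuous_snd).stronglyMeasurable
  have h3 := continuous_sesq.comp_stronglyMeasurable (h1.prodMk h2)
  exact h3

/-- The operator with kernel `i η(x) j η(t)*` is similar to `A` if the derivative `γ` of `η` is
square integrably differentiable and the curve is normalized. -/
theorem exists_similarity_of_normalized (hr : 0 < r)
    {η γ δ : ℝ → Matrix (Fin m₂) (Fin m₁ ⊕ Fin m₂) ℂ}
    (hη : HasL2Deriv r η γ) (hγ : HasL2Deriv r γ δ)
    (h0 : ∀ x ∈ Icc 0 r, η x * sgnJ m₁ m₂ * (η x)ᴴ = 0)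
    (h1 : ∀ x ∈ Icc 0 r, γ x * sgnJ m₁ m₂ * (η x)ᴴ = Complex.I • 1)
    (h2 : ∀ x ∈ Icc 0 r, γ x * sgnJ m₁ m₂ * (γ x)ᴴ = 0) :
    ∃ (w κ : ℝ → ℝ → EuclideanSpace ℂ (Fin m₂) →L[ℂ] EuclideanSpace ℂ (Fin m₂))
      (hw : IsBddKer w) (hκ : IsBddKer κ),
      (∀ x t, x < t → w x t = 0) ∧ (∀ x t, x < t → κ x t = 0) ∧
      (∀ x t, 0 ≤ t → t ≤ x → x ≤ r → κ x t = sesq (η x) (η t)) ∧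
      hκ.op r * (1 + hw.op r) = (1 + hw.op r) * opA m₂ r := by
  obtain ⟨ηc, cη, bη, eη⟩ := exists_continuous_extension hr.le hη.continuousOn
  obtain ⟨γc, cγ, bγ, eγ⟩ := exists_continuous_extension hr.le hγ.continuousOn
  have hη' := hη.congr_left eη
  have hγ' := hγ.congr_left eγ
  -- The kernel equation needs a strongly measurable `q`, while `δ` is only almost everywhere equal
  -- to such a function; changing it on a null set leaves its primitive `γ` unchanged.
  set δc := (Ioo 0 r).indicator (hγ.1.aestronglyMeasurable.mk δ) with hδc
  have hδm : StronglyMeasurable δc :=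
    hγ.1.aestronglyMeasurable.stronglyMeasurable_mk.indicator measurableSet_Ioo
  have hγδ : HasL2Deriv r γc δc := hγ'.congr_ae (by
    filter_upwards [hγ.1.aestronglyMeasurable.ae_eq_mk, ae_restrict_mem measurableSet_Ioo]
      with x hx1 hx2
    rw [hδc, indicator_of_mem hx2, hx1])
  have hηγ : HasL2Deriv r ηc γc := hη'.congr_ae (by
    filter_upwards [ae_restrict_mem measurableSet_Ioo] with x hx
    exact (eγ x (Ioo_subset_Icc_self hx)).symm)
  obtain ⟨D, hD⟩ := bγ
  have hκ := isBddKer_sesq cη cη bη bη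
  have mem : ∀ {x t : ℝ}, 0 ≤ t → t ≤ x → x ≤ r → x ∈ Icc 0 r ∧ t ∈ Icc 0 r := fun a b c =>
    ⟨⟨a.trans b, c⟩, ⟨a, b.trans c⟩⟩
  have hqm : StronglyMeasurable (Function.uncurry fun x t => sesq (δc x) (γc t)) :=
    stronglyMeasurable_sesq hδm cγ
  have hμ : MemLp (fun x => ‖sgnJ m₁ m₂‖ * D * ‖δc x‖) 2 (volume.restrict (Ioo 0 r)) :=
    hγδ.1.norm.const_mul _
  have hqμ : ∀ x t, ‖sesq (δc x) (γc t)‖ ≤ ‖sgnJ m₁ m₂‖ * D * ‖δc x‖ := fun x t =>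
    (norm_sesq_le _ _).trans (by gcongr; exact hD t)
  have hρ := isBddKer_sesq cγ cγ ⟨D, hD⟩ ⟨D, hD⟩
  have hσ := isBddKer_sesq cγ cη ⟨D, hD⟩ bη
  have hqρ : ∀ x t, 0 ≤ t → t ≤ x → x ≤ r →
      ∫ s in t..x, sesq (δc s) (γc t) = sesq (γc x) (γc t) := by
    intro x t h3 h4 h5
    obtain ⟨hx, ht⟩ := mem h3 h4 h5
    have := (sesqLeft (γc t)).intervalIntegral_comp_comm (hγδ.intervalIntegrable ht hx)
    rw [hγδ.integral_eq_sub ht hx, map_sub] at this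
    -- The purpose of the frame: `γ j γ* = 0` removes the boundary term, so that the kernel of `R`
    -- is exactly a primitive of `q`.
    have e : sesqLeft (γc t) (γc t) = 0 := by
      change sesq _ _ = _
      rw [sesq, eγ t ht, h2 t ht, smul_zero, map_zero]
    rw [e, sub_zero] at this
    exact this
  have hρσ : ∀ x t, 0 ≤ t → t ≤ x → x ≤ r →
      ∫ s in t..x, sesq (γc x) (γc s) = -1 - sesq (γc x) (ηc t) := by
    intro x t h3 h4 h5
    obtain ⟨hx, ht⟩ := mem h3 h4 h5
    have := (sesqRight (γc x)).intervalIntegral_comp_comm (hηγ.intervalIntegrable ht hx)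
    rw [hηγ.integral_eq_sub ht hx, map_sub] at this
    -- The diagonal value `i · i = -1` from `γ j η* = i` produces the leading term `-J` in `R J = -J
    -- - S`.
    have e : sesqRight (γc x) (ηc x) = -1 := by
      change sesq _ _ = _
      rw [sesq, eγ x hx, eη x hx, h1 x hx, smul_smul, Complex.I_mul_I, neg_one_smul,
        map_neg, map_one]
    rw [e] at this
    exact this
  have hσκ : ∀ x t, 0 ≤ t → t ≤ x → x ≤ r →
      ∫ s in t..x, sesq (γc s) (ηc t) = sesq (ηc x) (ηc t) := by
    intro x t h3 h4 h5
    obtain ⟨hx, ht⟩ := mem h3 h4 h5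
    have := (sesqLeft (ηc t)).intervalIntegral_comp_comm (hηγ.intervalIntegrable ht hx)
    rw [hηγ.integral_eq_sub ht hx, map_sub] at this
    have e : sesqLeft (ηc t) (ηc t) = 0 := by
      change sesq _ _ = _
      rw [sesq, eη t ht, h0 t ht, smul_zero, map_zero]
    rw [e, sub_zero] at this
    exact this
  obtain ⟨w, hw, hw0, h⟩ := exists_similarity hr hqm hμ hqμ hρ hσ hκ hqρ hρσ hσκ
  refine ⟨w, _, hw, hκ.cutTriangle r, hw0, fun x t h => cutTriangle_of_lt h _,
    fun x t h3 h4 h5 => ?_, h⟩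
  obtain ⟨hx, ht⟩ := mem h3 h4 h5
  rw [cutTriangle_of_le h3 h4 h5, eη x hx, eη t ht]

theorem toEuclideanCLM_mul_apply (A B : Matrix (Fin m₂) (Fin m₂) ℂ)
    (v : EuclideanSpace ℂ (Fin m₂)) :
    Matrix.toEuclideanCLM (𝕜 := ℂ) (n := Fin m₂) (A * B) v =
      Matrix.toEuclideanCLM (𝕜 := ℂ) (n := Fin m₂) A
        (Matrix.toEuclideanCLM (𝕜 := ℂ) (n := Fin m₂) B v) := by
  rw [map_mul]; rfl

/-- A unitary frame gives rise to an invertible multiplication operator. -/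
theorem exists_unitary_mulOp {u : ℝ → Matrix (Fin m₂) (Fin m₂) ℂ} (hu : ContinuousOn u (Icc 0 r))
    (huu : ∀ x ∈ Icc 0 r, u x ∈ Matrix.unitaryGroup (Fin m₂) ℂ) :
    ∃ U : L2 m₂ r ≃L[ℂ] L2 m₂ r, ∀ f, U f =ᵐ[volume.restrict (Ioo 0 r)]
      fun x => Matrix.toEuclideanCLM (𝕜 := ℂ) (n := Fin m₂) (u x) (f x) := by
  have hu' : ContinuousOn (fun x => (u x)ᴴ) (Icc 0 r) :=
    (continuous_id.matrix_conjTranspose).comp_continuousOn hu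
  have aux : ∀ v : ℝ → Matrix (Fin m₂) (Fin m₂) ℂ, ContinuousOn v (Icc 0 r) →
      ∃ U : L2 m₂ r →L[ℂ] L2 m₂ r, ∀ f, U f =ᵐ[volume.restrict (Ioo 0 r)]
        fun x => Matrix.toEuclideanCLM (𝕜 := ℂ) (n := Fin m₂) (v x) (f x) := fun v hv => by
    have hv' := continuousOn_matCLM hv
    obtain ⟨C, hC⟩ := isCompact_Icc.exists_bound_of_continuousOn hv'
    exact exists_mulOp (u := fun x => (Matrix.toEuclideanLin (v x)).toContinuousLinearMap)
      ((hv'.mono Ioo_subset_Icc_self).aestronglyMeasurable measurableSet_Ioo)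
      fun x hx => hC x (Ioo_subset_Icc_self hx)
  obtain ⟨U, hU⟩ := aux u hu
  obtain ⟨T, hT⟩ := aux _ hu'
  refine ⟨ContinuousLinearEquiv.equivOfInverse U T (fun f => Lp.ext ?_) (fun f => Lp.ext ?_), hU⟩
  · filter_upwards [hU f, hT (U f), ae_restrict_mem measurableSet_Ioo] with x h1 h2 hx
    rw [h2, h1, ← toEuclideanCLM_mul_apply, ← Matrix.star_eq_conjTranspose,
      Matrix.mem_unitaryGroup_iff'.1 (huu x (Ioo_subset_Icc_self hx)), map_one]
    rfl
  · filter_upwards [hT f, hU (T f), ae_restrict_mem measurableSet_Ioo] with x h1 h2 hx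
    rw [h2, h1, ← toEuclideanCLM_mul_apply, ← Matrix.star_eq_conjTranspose,
      Matrix.mem_unitaryGroup_iff.1 (huu x (Ioo_subset_Icc_self hx)), map_one]
    rfl

/-- The operator `K` in the moving frame `u`. -/
theorem opK_comp_frame {β : ℝ → Matrix (Fin m₂) (Fin m₁ ⊕ Fin m₂) ℂ} (hβ : MemU r β)
    {u : ℝ → Matrix (Fin m₂) (Fin m₂) ℂ}
    (huu : ∀ x ∈ Icc 0 r, u x ∈ Matrix.unitaryGroup (Fin m₂) ℂ)
    {U : L2 m₂ r →L[ℂ] L2 m₂ r} (hU : ∀ f, U f =ᵐ[volume.restrict (Ioo 0 r)]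
      fun x => Matrix.toEuclideanCLM (𝕜 := ℂ) (n := Fin m₂) (u x) (f x))
    {κ : ℝ → ℝ → EuclideanSpace ℂ (Fin m₂) →L[ℂ] EuclideanSpace ℂ (Fin m₂)} (hκ : IsBddKer κ)
    (hκ0 : ∀ x t, x < t → κ x t = 0)
    (hκη : ∀ x t, 0 ≤ t → t ≤ x → x ≤ r →
      κ x t = sesq ((u x)ᴴ * β x) ((u t)ᴴ * β t)) :
    opK β hβ * U = U * hκ.op r := by
  ext1 f
  refine Lp.ext ?_
  filter_upwards [coeFn_opK hβ (U f), hU (hκ.op r f), hκ.coeFn_op f,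
    ae_restrict_mem measurableSet_Ioo] with x h1 h2 h3 hx
  have hx' := Ioo_subset_Icc_self hx
  have hsub := subset_Ioo_aux hx'
  change opK β hβ (U f) x = U (hκ.op r f) x
  have hκx : ∫ t in Ioo 0 r, κ x t (f t) = ∫ t in Ioo 0 x, κ x t (f t) := by
    rw [← integral_eq_Ioo hx', ← setIntegral_ite_le hx']
    refine setIntegral_congr_fun measurableSet_Ioo fun t _ => ?_
    split_ifs with h
    · rfl
    · rw [hκ0 x t (not_le.1 h)]; rfl
  rw [h1, h2, h3, hκx, Kfun, integral_eq_Ioo hx']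
  have hβs : ContinuousOn (fun x => (β x)ᴴ) (Icc 0 r) :=
    (continuous_id.matrix_conjTranspose).comp_continuousOn hβ.continuousOn
  have i1 : IntegrableOn (fun t => Matrix.toEuclideanLin (β t)ᴴ (U f t)) (Ioo 0 x) :=
    (integrableOn_aux (continuousOn_matCLM hβs) (L2.integrableOn (U f))).mono_set hsub
  have i2 : IntegrableOn (fun t => κ x t (f t)) (Ioo 0 x) :=
    (hκ.integrable_apply (L2.integrableOn f) x).mono_set hsub
  have e1 := (Matrix.toEuclideanLin (β x * sgnJ m₁ m₂)).toContinuousLinearMap.integral_comp_comm i1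
  simp only [LinearMap.coe_toContinuousLinearMap'] at e1
  rw [← e1, ← integral_smul, ← ContinuousLinearMap.integral_comp_comm _ i2]
  refine integral_congr_ae ?_
  filter_upwards [ae_restrict_of_ae_restrict_of_subset hsub (hU f),
    ae_restrict_mem measurableSet_Ioo] with t ht htx
  rw [ht, hκη x t htx.1.le htx.2.le hx.2.le, sesq, ← toEuclideanCLM_mul_apply]
  have huni := Matrix.mem_unitaryGroup_iff.1 (huu x hx')
  rw [Matrix.star_eq_conjTranspose] at huni
  -- The outer frame cancels by `u u* = 1`; the inner one leaves the factor `u t` coming from `U f`.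
  have e2 : u x * Complex.I • ((u x)ᴴ * β x * sgnJ m₁ m₂ * ((u t)ᴴ * β t)ᴴ) =
      Complex.I • (β x * sgnJ m₁ m₂ * ((β t)ᴴ * u t)) := by
    rw [Matrix.mul_smul, Matrix.conjTranspose_mul, Matrix.conjTranspose_conjTranspose]
    simp only [← Matrix.mul_assoc]
    rw [huni, Matrix.one_mul]
  rw [e2, map_smul, smul_apply]
  congr 1
  apply WithLp.ofLp_injective
  simp [Matrix.toLpLin_apply, Matrix.mulVec_mulVec, Matrix.mul_assoc]

end Assembly

end CanonicalSystem

end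

theorem theorem2p5 (m₁ m₂ : ℕ) (r : ℝ) (hr : 0 < r)
    (β : ℝ → Matrix (Fin m₂) (Fin m₁ ⊕ Fin m₂) ℂ)
    (hβ : CanonicalSystem.MemU r β) (hnorm : CanonicalSystem.IsNormalized r β) :
    ∃ (u : ℝ → Matrix (Fin m₂) (Fin m₂) ℂ) (𝒱 : ℝ → ℝ → Matrix (Fin m₂) (Fin m₂) ℂ)
      (V : CanonicalSystem.L2 m₂ r ≃L[ℂ] CanonicalSystem.L2 m₂ r),
      CanonicalSystem.MemU r u ∧
      (∀ x ∈ Icc 0 r, u x ∈ Matrix.unitaryGroup (Fin m₂) ℂ) ∧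
      (∀ i j, Measurable fun p : ℝ × ℝ => 𝒱 p.1 p.2 i j) ∧
      (∃ C : ℝ, ∀ x t, 0 ≤ t → t ≤ x → x ≤ r → ‖𝒱 x t‖ ≤ C) ∧
      (∀ f : CanonicalSystem.L2 m₂ r, V f =ᵐ[volume.restrict (Ioo 0 r)] fun x =>
        Matrix.toEuclideanLin (u x)
          (f x + ∫ t in (0 : ℝ)..x, Matrix.toEuclideanLin (𝒱 x t) (f t))) ∧
      CanonicalSystem.opK β hβ =
        (V : CanonicalSystem.L2 m₂ r →L[ℂ] CanonicalSystem.L2 m₂ r) ∘L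
          CanonicalSystem.opA m₂ r ∘L
          (V.symm : CanonicalSystem.L2 m₂ r →L[ℂ] CanonicalSystem.L2 m₂ r) := by
  open CanonicalSystem in
  obtain ⟨u, γ, δ, hu, huu, hη, hγ, hn⟩ := exists_normalizing_frame hr hβ hnorm
  obtain ⟨w, κ, hw, hκ, hw0, hκ0, hκη, hsim⟩ := exists_similarity_of_normalized hr hη hγ
    (fun x hx => (hn x hx).1) (fun x hx => (hn x hx).2.1) (fun x hx => (hn x hx).2.2)
  obtain ⟨U, hU⟩ := exists_unitary_mulOp hu.continuousOn huu
  obtain ⟨T, hT⟩ := hw.isUnit_one_add_op hr hw0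
  set T' : L2 m₂ r ≃L[ℂ] L2 m₂ r := ContinuousLinearEquiv.unitsEquiv ℂ (L2 m₂ r) T with hT'
  have hTw : (T' : L2 m₂ r →L[ℂ] L2 m₂ r) = 1 + hw.op r := hT
  have hTf : ∀ f, T' f = f + hw.op r f := fun f => by
    change (T' : L2 m₂ r →L[ℂ] L2 m₂ r) f = _
    rw [hTw]; rfl
  have hKU := opK_comp_frame hβ huu (U := (U : L2 m₂ r →L[ℂ] L2 m₂ r)) hU hκ hκ0 hκη
  set Φ := Matrix.toEuclideanCLM (𝕜 := ℂ) (n := Fin m₂)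
  -- `V = U (1 + W)`, and the matrix kernel is `w` read back through the isometry `Φ` between
  -- matrices and operators.
  refine ⟨u, fun x t => Φ.symm (w x t), T'.trans U, hu, huu, fun i j => ?_, ?_, fun f => ?_, ?_⟩
  · have hc : Continuous fun L : EuclideanSpace ℂ (Fin m₂) →L[ℂ] EuclideanSpace ℂ (Fin m₂) =>
        Φ.symm L i j :=
      LinearMap.continuous_of_finiteDimensional
        ((Matrix.entryLinearMap ℂ ℂ i j).comp Φ.symm.toAlgEquiv.toLinearMap)
    exact (hc.comp_stronglyMeasurable hw.1).measurable
  · obtain ⟨C, hC⟩ := hw.2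
    refine ⟨C, fun x t _ _ _ => ?_⟩
    rw [Matrix.cstar_norm_def]
    change ‖Φ (Φ.symm (w x t))‖ ≤ C
    rw [StarAlgEquiv.apply_symm_apply]
    exact hC x t
  · filter_upwards [hU (T' f), Lp.coeFn_add f (hw.op r f), hw.coeFn_op f,
      ae_restrict_mem measurableSet_Ioo] with x h1 h2 h3 hx
    have hx' := Ioo_subset_Icc_self hx
    change U (T' f) x = _
    rw [h1, hTf, h2, Pi.add_apply, h3]
    change Matrix.toEuclideanLin (u x) _ = _
    congr 2
    rw [← setIntegral_ite_le hx']
    refine setIntegral_congr_fun measurableSet_Ioo fun t _ => ?_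
    split_ifs with h
    · change _ = Φ (Φ.symm (w x t)) (f t)
      rw [StarAlgEquiv.apply_symm_apply]
    · rw [hw0 x t (not_le.1 h)]; rfl
  · ext1 f
    -- Testing on `f = V g` cancels `V⁻¹` and leaves `K V g = V A g`, which is the frame identity
    -- followed by the similarity.
    obtain ⟨g, rfl⟩ := (T'.trans U).surjective f
    have e1 := congrArg (fun L : L2 m₂ r →L[ℂ] L2 m₂ r => L (T' g)) hKU
    have e2 := congrArg (fun L : L2 m₂ r →L[ℂ] L2 m₂ r => U (L g)) hsim
    rw [← hTw] at e2
    simp only [ContinuousLinearMap.comp_apply, ContinuousLinearEquiv.coe_coe,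
      ContinuousLinearEquiv.symm_apply_apply]
    exact e1.trans e2
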